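/- **Setting.** Let $N,d\ge 1$, $\sigma>0$, let $\mathbb X\in\mathbb R^{N\times d}$ be a deterministic matrix, and $Y=\mathbb Xt^*+\xi$ with $t^*\in\mathbb R^d$ and $\xi\sim\mathcal N(0,\sigma^2I_N)$. Write $\|u\|_{L_2^N}^2=\frac1N\sum_{i=1}^N u_i^2$ for $u\in\mathbb R^N$ and, for $\rho\ge0$, $$m_{\mathbb X}(\rho)=\min\Big(\frac{\sigma^2\,\mathrm{Rank}(\mathbb X)}{N},\ \rho\sigma\sqrt{\tfrac1N\log\Big(\frac{e\sigma d}{\rho\sqrt N}\Big)},\ \rho\sigma\sqrt{\frac{\log(ed)}{N}}\Big),$$ where here and below the logarithm in the second term is replaced by $1$ when it is smaller than $1$, i.e. when $\rho\sqrt N>\sigma d$ (the minimum is then $\sigma^2\mathrm{Rank}(\mathbb X)/N$), and the second term is $0$ at $\rho=0$. Let $\overline{r}_{\mathbb X}^{\,2}(\rho)=C_{\mathbb X}(\rho)\,m_{\mathbb X}(\rho)$, where $C_{\mathbb X}(\cdot)$ is any function (it may be constant, and may depend on $\rho,d,\sigma,N,\mathbb X$) with $C_1\le C_{\mathbb X}\le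 C_2$, and $\Psi(\rho)=c_0'\,\overline{r}_{\mathbb X}^{\,2}(\rho)$. A RERM is any $$\hat t\in\operatorname*{argmin}_{t\in\mathbb R^d}\big(\|Y-\mathbb Xt\|_{L_2^N}^2+\Psi(\|t\|_1)\big).$$ **Theorem.** There is an absolute constant $C_0>0$ such that for all constants $C_2\ge C_1\ge C_0$ and $c_0'\ge2$ the following hold. 1. There are $\kappa_1,\kappa_2,\kappa_3>0$ depending only on $C_1,C_2,c_0'$ such that for all $N,d,\sigma,\mathbb X,t^*$ and $C_{\mathbb X}$ as above, if every column of $\mathbb X$ has $L_2^N$-norm at most $1$, i.e. $\sum_{i}\mathbb X_{ij}^2\le N$ for all $j$ (in particular if the columns are in the Euclidean unit ball $B_2^N$), then with probability at least $1-\kappa_1\exp\big(-\kappa_2N\,\overline r_{\mathbb X}^{\,2}(\|t^*\|_1)/\sigma^2\big)$ every RERM $\hat t$ satisfies $$\|\mathbb X(\hat t-t^*)\|_{L_2^N}^2\le\kappa_3\,m_{\mathbb X}(\|t^*\|_1).$$ 2. If $C_{\mathbb X}$ is a constant, a RERM exists for every $Y\in\mathbb R^N$ (and every $\mathbb X$).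 3. There is $\Delta_0>0$ depending only on $C_1,C_2,c_0'$ such that for all $A,g_0>0$ there is $g_1>0$ depending only on $A,g_0,C_1,C_2,c_0'$ with the following property. Let $\mathbb X$ satisfy RIP: $\frac12\|t\|_2\le\|\mathbb Xt\|_{L_2^N}\le\frac32\|t\|_2$ holds for all $t\in\mathbb R^d$ if $N\ge d$, while if $N<d$ then $s:=N/\log(ed/N)>1$ and it holds for all $t$ with at most $s$ nonzero coordinates. Suppose that for every $\rho\ge0$ the quantity $A\min\big(\frac{\sigma^2\mathrm{Rank}(\mathbb X)}{N},\rho\sigma\sqrt{\frac1N\log(\frac{e\sigma d}{\rho\sqrt N})},\rho^2\big)$ is a minimax rate of convergence over $\rho B_1^d=\{t:\|t\|_1\le\rho\}$ for the confidence $3/4$. Then $\Psi$ is a minimax regularization function for the $\ell_1$-norm over $\{t^*:\|t^*\|_1>\Delta_0\sigma\sqrt{\log(ed)/N}\}$ for the confidence $3/4$: for each such $t^*$ and each minimax rate $R$ over $\|t^*\|_1B_1^d$ for the confidence $3/4$, with probability at least $3/4$ every RERM $\hat t$ satisfies $\|\mathbb X(\hat t-t^*)\|_{L_2^N}^2\le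 g_1R$. Here $R$ is a minimax rate of convergence over $T\subset\mathbb R^d$ for the confidence $1-\delta$ if some measurable $\hat t:\mathbb R^N\to\mathbb R^d$ satisfies $\mathbb P\big(\|\mathbb X(\hat t(\mathbb Xt+\xi)-t)\|_{L_2^N}^2\le R\big)\ge1-\delta$ for all $t\in T$, and any measurable $\tilde t$ satisfying the same with $\zeta$ in place of $R$ has $\zeta\ge g_0R$. -/

import Mathlib

open MeasureTheory ProbabilityTheory

noncomputable section

namespace FixedDesign

/-- The `ℓ₁` norm on `ℝᵈ`. -/
def l1 {d : ℕ} (t : Fin d → ℝ) : ℝ := ∑ j, |t j|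

/-- The squared empirical norm `‖u‖²_{L₂ᴺ} = (1/N) ∑ uᵢ²` on `ℝᴺ`. -/
def empSq {N : ℕ} (u : Fin N → ℝ) : ℝ := (∑ i, u i ^ 2) / N

/-- The law `𝒩(0, σ² I_N)` of the noise vector on `ℝᴺ`. -/
def noise (N : ℕ) (σ : ℝ) : Measure (Fin N → ℝ) :=
  Measure.pi fun _ => gaussianReal 0 (σ.toNNReal ^ 2)

/-- The term `ρ σ √(log(eσd / (ρ√N)) / N)`. The logarithm is truncated from below at `1`; this
only concerns radii `ρ√N > σd`, where the formula without truncation stops increasing and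
finally is meaningless. There this term is at least `σ² d / N`, so that the minima below are
given by `σ² Rank(X) / N`. -/
def midTerm (N d : ℕ) (σ ρ : ℝ) : ℝ :=
  ρ * σ * √(max 1 (Real.log (Real.exp 1 * σ * d / (ρ * √N))) / N)

/-- `min (σ² Rank(X) / N, ρσ √(log(eσd/(ρ√N)) / N), ρσ √(log(ed) / N))`. -/
def rate {N d : ℕ} (X : Matrix (Fin N) (Fin d) ℝ) (σ ρ : ℝ) : ℝ :=
  min (σ ^ 2 * X.rank / N)
    (min (midTerm N d σ ρ) (ρ * σ * √(Real.log (Real.exp 1 * d) / N)))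

/-- The squared complexity parameter `r̄_X²(ρ) = C_X(ρ) · rate(ρ)`; the factor `Γ = C_X` is
allowed to depend on `ρ`. -/
def rbarSq {N d : ℕ} (Γ : ℝ → ℝ) (X : Matrix (Fin N) (Fin d) ℝ) (σ ρ : ℝ) : ℝ :=
  Γ ρ * rate X σ ρ

/-- `t` is a regularized empirical risk minimizer for the design `X`, the regularization
function `Ψ` (of the `ℓ₁` norm) and the data `y`. -/
def IsRERM {N d : ℕ} (X : Matrix (Fin N) (Fin d) ℝ) (Ψ : ℝ → ℝ) (y : Fin N → ℝ)
    (t : Fin d → ℝ) : Prop :=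
  ∀ s : Fin d → ℝ, empSq (y - X.mulVec t) + Ψ (l1 t) ≤ empSq (y - X.mulVec s) + Ψ (l1 s)

/-- The event (set of noise vectors) on which some regularized empirical risk minimizer built
from `Y = X t* + ξ` has squared prediction error larger than `b`. -/
def badEvent {N d : ℕ} (X : Matrix (Fin N) (Fin d) ℝ) (Ψ : ℝ → ℝ) (tstar : Fin d → ℝ)
    (b : ℝ) : Set (Fin N → ℝ) :=
  {ξ | ∃ t, IsRERM X Ψ (X.mulVec tstar + ξ) t ∧ b < empSq (X.mulVec (t - tstar))}

/-- The statistic `est` performs with accuracy `ζ` and confidence `1 - δ` relative to the set of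
targets `T`. -/
def Performs {N d : ℕ} (X : Matrix (Fin N) (Fin d) ℝ) (σ δ : ℝ) (T : Set (Fin d → ℝ))
    (est : (Fin N → ℝ) → (Fin d → ℝ)) (ζ : ℝ) : Prop :=
  ∀ t ∈ T, ENNReal.ofReal (1 - δ) ≤
    noise N σ {ξ | empSq (X.mulVec (est (X.mulVec t + ξ) - t)) ≤ ζ}

/-- `R` is a minimax rate of convergence over `T` for the confidence `1 - δ`, with constant `g`
in the lower bound. -/
def IsMinimaxRate {N d : ℕ} (g : ℝ) (X : Matrix (Fin N) (Fin d) ℝ) (σ δ : ℝ)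
    (T : Set (Fin d → ℝ)) (R : ℝ) : Prop :=
  (∃ est : (Fin N → ℝ) → (Fin d → ℝ), Measurable est ∧ Performs X σ δ T est R) ∧
  ∀ (est : (Fin N → ℝ) → (Fin d → ℝ)) (ζ : ℝ), Measurable est → Performs X σ δ T est ζ →
    g * R ≤ ζ

/-- `Ψ` is a minimax regularization function for the `ℓ₁` norm over `T` for the confidence
`1 - δ`: for all `t* ∈ T`, outside an event of probability at most `δ`, every minimizer has
error at most `g₁ R`, for `R` the minimax rate over `{t : ‖t‖₁ ≤ ‖t*‖₁}` (the minimax rate being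
understood with constant `g₀` in the lower bound). -/
def IsMinimaxRegularization {N d : ℕ} (g₀ g₁ : ℝ) (X : Matrix (Fin N) (Fin d) ℝ) (σ δ : ℝ)
    (T : Set (Fin d → ℝ)) (Ψ : ℝ → ℝ) : Prop :=
  ∀ tstar ∈ T, ∀ R : ℝ, IsMinimaxRate g₀ X σ δ {t | l1 t ≤ l1 tstar} R →
    noise N σ (badEvent X Ψ tstar (g₁ * R)) ≤ ENNReal.ofReal δ

/-- `½‖t‖₂ ≤ ‖X t‖_{L₂ᴺ} ≤ (3/2)‖t‖₂`. -/
def IsoAt {N d : ℕ} (X : Matrix (Fin N) (Fin d) ℝ) (t : Fin d → ℝ) : Prop :=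
  1 / 2 * √(∑ j, t j ^ 2) ≤ √(empSq (X.mulVec t)) ∧
    √(empSq (X.mulVec t)) ≤ 3 / 2 * √(∑ j, t j ^ 2)

/-- The restricted isometry property: if `N < d`, the sparsity level `s = N / log(ed/N)` is
larger than `1` and `X` is nearly isometric on `s`-sparse vectors; if `d ≤ N`, it is nearly
isometric on `ℝᵈ`. -/
def RIP {N d : ℕ} (X : Matrix (Fin N) (Fin d) ℝ) : Prop :=
  (N < d → 1 < (N : ℝ) / Real.log (Real.exp 1 * d / N) ∧
    ∀ t : Fin d → ℝ,
      ((Finset.univ.filter fun j => t j ≠ 0).card : ℝ) ≤ N / Real.log (Real.exp 1 * d / N) →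
      IsoAt X t) ∧
  (d ≤ N → ∀ t : Fin d → ℝ, IsoAt X t)

/-- The expression
`min (σ² Rank(X) / N, ρσ √(log(eσd/(ρ√N)) / N), ρ²)` of the minimax rate over `ρ B₁ᵈ`. -/
def l1BallRate {N d : ℕ} (X : Matrix (Fin N) (Fin d) ℝ) (σ ρ : ℝ) : ℝ :=
  min (σ ^ 2 * X.rank / N) (min (midTerm N d σ ρ) (ρ ^ 2))

end FixedDesign

end

namespace FixedDesign

/-! Put `u = t̂ - t*`. Optimality of `t̂` gives `|Xu|² ≤ 2⟨Xu, ξ⟩ + N(Ψ(‖t*‖₁) - Ψ(‖t̂‖₁))`.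
Everything rests on one event on which, for all `ρ` and all `u` with `‖u‖₁ ≤ ρ` simultaneously,
`2⟨Xu, ξ⟩ ≤ |Xu|²/2 + 51(N·rate(ρ) + σ²s)` (`IsGoodNoise.dotProduct_le`); it fails with probability
at most `2e⁻ˢ` (`noise_not_isGoodNoise_le`). For `ρ` twice the larger of `‖t̂‖₁`, `‖t*‖₁`, doubling
gives `rate(ρ) ≤ 2(rate(‖t̂‖₁) + rate(‖t*‖₁))`. Since `C₀ = 51` and `c₀ ≥ 2`, the penalty of `t̂`
absorbs its own share, and only `rate(‖t*‖₁)` and `σ²s/N` remain (`IsGoodNoise.empSq_le`).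

The rank part of the event is a chi-square bound for the projection of `ξ` onto the range of `X`.
The `ℓ₁` part is a derandomized Maurey argument: `|z|²/2 - 2⟨z, ξ⟩` at some average of `k` vertices
of `X(yB₁)` exceeds its value at a given point of that set by at most `O(y²N/k)`, so a union bound
over averages suffices. There are at most `exp(3k log(ed/k))` of them, and `y = k√(log(ed/k)) σ/√N`
balances both errors. The levels `k = 1, …, d` cover all radii at which the rank is not the smallest
term.

Minimaxity follows because above the threshold radius the rate is at most `l1BallRate` and at least
`σ²/N`. Minimizers exist because the penalty is continuous and constant, at its maximum, for large
radii. -/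

instance instIsProbabilityMeasureNoise (N : ℕ) (σ : ℝ) : IsProbabilityMeasure (noise N σ) := by
  unfold noise; infer_instance

/-! ### Exponential moments and tails of the Gaussian noise -/

theorem lintegral_noise_prod {N : ℕ} {σ : ℝ} {f : Fin N → ℝ → ℝ} (hf : ∀ i x, 0 ≤ f i x)
    (hi : ∀ i, Integrable (f i) (gaussianReal 0 (σ.toNNReal ^ 2))) :
    ∫⁻ ξ, ENNReal.ofReal (∏ i, f i (ξ i)) ∂noise N σ =
      ENNReal.ofReal (∏ i, ∫ x, f i x ∂gaussianReal 0 (σ.toNNReal ^ 2)) := by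
  unfold noise
  rw [← integral_fintype_prod_eq_prod (𝕜 := ℝ), ofReal_integral_eq_lintegral_ofReal]
  · exact Integrable.fintype_prod hi
  · exact Filter.Eventually.of_forall fun ξ => Finset.prod_nonneg fun i _ => hf i _

/-- The moment generating function of the noise vector. -/
theorem lintegral_exp_dotProduct_noise {N : ℕ} {σ : ℝ} (hσ : 0 ≤ σ) (a : Fin N → ℝ) :
    ∫⁻ ξ, ENNReal.ofReal (Real.exp (a ⬝ᵥ ξ)) ∂noise N σ =
      ENNReal.ofReal (Real.exp (σ ^ 2 / 2 * (a ⬝ᵥ a))) := by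
  have h1 : ∀ ξ : Fin N → ℝ, Real.exp (a ⬝ᵥ ξ) = ∏ i, Real.exp (a i * ξ i) := fun ξ => by
    rw [dotProduct, Real.exp_sum]
  simp_rw [h1]
  rw [lintegral_noise_prod (f := fun i x => Real.exp (a i * x))
    (fun i x => (Real.exp_pos _).le) (fun i => integrable_exp_mul_gaussianReal (a i))]
  have h2 : ∀ i, ∫ x, Real.exp (a i * x) ∂gaussianReal 0 (σ.toNNReal ^ 2) =
      Real.exp (σ ^ 2 / 2 * (a i * a i)) := fun i => by
    have := congrFun (mgf_fun_id_gaussianReal (μ := 0) (v := σ.toNNReal ^ 2)) (a i)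
    rw [mgf] at this
    rw [this]
    congr 1
    push_cast
    rw [Real.coe_toNNReal _ hσ]
    ring
  simp_rw [h2]
  rw [dotProduct, Finset.mul_sum, Real.exp_sum]

/-- The Markov inequality for the exponential moment of `f`. -/
theorem noise_lt_le_of_lintegral_exp {N : ℕ} {σ b D : ℝ} {f : (Fin N → ℝ) → ℝ}
    (hf : Measurable f)
    (h : ∫⁻ ξ, ENNReal.ofReal (Real.exp (f ξ)) ∂noise N σ ≤ ENNReal.ofReal (Real.exp b)) :
    noise N σ {ξ | D < f ξ} ≤ ENNReal.ofReal (Real.exp (b - D)) := by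
  have hm : AEMeasurable (fun ξ => ENNReal.ofReal (Real.exp (f ξ))) (noise N σ) :=
    (Real.measurable_exp.comp hf).ennreal_ofReal.aemeasurable
  calc noise N σ {ξ | D < f ξ}
      ≤ noise N σ {ξ | ENNReal.ofReal (Real.exp D) ≤ ENNReal.ofReal (Real.exp (f ξ))} := by
        refine measure_mono fun ξ hξ => ?_
        exact ENNReal.ofReal_le_ofReal (Real.exp_le_exp.2 (le_of_lt hξ))
    _ ≤ (∫⁻ ξ, ENNReal.ofReal (Real.exp (f ξ)) ∂noise N σ) / ENNReal.ofReal (Real.exp D) :=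
        meas_ge_le_lintegral_div hm (by simp [Real.exp_pos]) ENNReal.ofReal_ne_top
    _ ≤ ENNReal.ofReal (Real.exp b) / ENNReal.ofReal (Real.exp D) := by gcongr
    _ = ENNReal.ofReal (Real.exp (b - D)) := by
        rw [← ENNReal.ofReal_div_of_pos (Real.exp_pos D), Real.exp_sub]

theorem measurable_dotProduct_left {N : ℕ} (a : Fin N → ℝ) :
    Measurable fun ξ : Fin N → ℝ => a ⬝ᵥ ξ := by
  unfold dotProduct; fun_prop

/-- The self-normalized tail bound in a fixed direction. -/
theorem noise_dotProduct_tail {N : ℕ} {σ : ℝ} (hσ : 0 < σ) (a : Fin N → ℝ) (D : ℝ) :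
    noise N σ {ξ | (a ⬝ᵥ a) / 2 + 4 * σ ^ 2 * D < 2 * (a ⬝ᵥ ξ)} ≤
      ENNReal.ofReal (Real.exp (-D)) := by
  -- With this Chernoff parameter the log-moment of `c • a` is exactly `|a|²/(8σ²)`, which the
  -- quadratic term in the event cancels; the bound is free of `a`.
  set c : ℝ := 1 / (2 * σ ^ 2) with hc
  have h := lintegral_exp_dotProduct_noise hσ.le (c • a)
  have h' := noise_lt_le_of_lintegral_exp (D := (a ⬝ᵥ a) / (8 * σ ^ 2) + D)
    (measurable_dotProduct_left (c • a)) h.le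
  have e : σ ^ 2 / 2 * ((c • a) ⬝ᵥ (c • a)) - ((a ⬝ᵥ a) / (8 * σ ^ 2) + D) = -D := by
    rw [smul_dotProduct, dotProduct_smul, hc]
    simp only [smul_eq_mul]
    field_simp
    ring
  rw [e] at h'
  refine le_trans (measure_mono fun ξ hξ => ?_) h'
  simp only [Set.mem_ofPred_eq, smul_dotProduct, smul_eq_mul] at hξ ⊢
  have : c * (a ⬝ᵥ ξ) = (1 / (4 * σ ^ 2)) * (2 * (a ⬝ᵥ ξ)) := by rw [hc]; field_simp; ring
  rw [this]
  calc (a ⬝ᵥ a) / (8 * σ ^ 2) + D = (1 / (4 * σ ^ 2)) * ((a ⬝ᵥ a) / 2 + 4 * σ ^ 2 * D) := by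
        field_simp
        ring
    _ < _ := by gcongr

theorem integral_exp_sq_div_four_gaussianReal :
    Integrable (fun x : ℝ => Real.exp (x ^ 2 / 4)) (gaussianReal 0 1) ∧
      ∫ x, Real.exp (x ^ 2 / 4) ∂gaussianReal 0 1 = √2 := by
  have e : ∀ x : ℝ, gaussianPDFReal 0 1 x * Real.exp (x ^ 2 / 4) =
      (√(2 * Real.pi))⁻¹ * Real.exp (-(1 / 4) * x ^ 2) := fun x => by
    rw [gaussianPDFReal, mul_assoc, ← Real.exp_add]
    simp only [NNReal.coe_one, mul_one, sub_zero]
    congr 2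
    ring
  constructor
  · rw [gaussianReal_of_var_ne_zero 0 one_ne_zero,
      integrable_withDensity_iff (measurable_gaussianPDF 0 1)
        (Filter.Eventually.of_forall fun x => gaussianPDF_lt_top)]
    simp_rw [toReal_gaussianPDF, mul_comm (Real.exp _), e]
    exact (integrable_exp_neg_mul_sq (by norm_num)).const_mul _
  · rw [integral_gaussianReal_eq_integral_smul one_ne_zero]
    simp_rw [smul_eq_mul, e]
    rw [integral_const_mul, integral_gaussian, ← Real.sqrt_inv, ← Real.sqrt_mul (by positivity)]
    congr 1
    field_simp
    norm_num

/-- The exponential moment of a projected noise vector. -/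
theorem lintegral_exp_sum_sq_noise {N r : ℕ} {σ : ℝ} (hσ : 0 < σ) (b : Fin r → Fin N → ℝ)
    (hb : ∀ i j, b i ⬝ᵥ b j = if i = j then 1 else 0) :
    ∫⁻ ξ, ENNReal.ofReal (Real.exp ((∑ i, (b i ⬝ᵥ ξ) ^ 2) / (4 * σ ^ 2))) ∂noise N σ ≤
      ENNReal.ofReal (Real.exp (r / 2)) := by
  -- Gaussian linearization: `exp(c²q²/2)` is the mean of `exp(chq)` over an independent standard
  -- normal `h`. After exchanging the integrals, orthonormality leaves independent factors
  -- `exp(hᵢ²/4)`, each of mean `√2 ≤ e^{1/2}`.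
  set c : ℝ := √(1 / 2) / σ with hc
  have hc2 : c ^ 2 = 1 / (2 * σ ^ 2) := by
    rw [hc, div_pow, Real.sq_sqrt (by norm_num)]; field_simp
  have h1 : ∀ ξ : Fin N → ℝ,
      ENNReal.ofReal (Real.exp ((∑ i, (b i ⬝ᵥ ξ) ^ 2) / (4 * σ ^ 2))) =
      ∫⁻ h, ENNReal.ofReal (Real.exp ((∑ i, h i • (c • b i)) ⬝ᵥ ξ)) ∂noise r 1 := fun ξ => by
    have := lintegral_exp_dotProduct_noise zero_le_one (fun i : Fin r => c * (b i ⬝ᵥ ξ))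
    have e1 : ∀ h : Fin r → ℝ, (∑ i, h i • (c • b i)) ⬝ᵥ ξ =
        (fun i : Fin r => c * (b i ⬝ᵥ ξ)) ⬝ᵥ h := fun h => by
      rw [sum_dotProduct, dotProduct]
      refine Finset.sum_congr rfl fun i _ => ?_
      simp only [smul_dotProduct, smul_eq_mul]
      ring
    simp_rw [e1]
    rw [this]
    congr 2
    rw [dotProduct, Finset.mul_sum, Finset.sum_div]
    refine Finset.sum_congr rfl fun i _ => ?_
    have : (1:ℝ) ^ 2 / 2 * (c * (b i ⬝ᵥ ξ) * (c * (b i ⬝ᵥ ξ))) = c ^ 2 / 2 * (b i ⬝ᵥ ξ) ^ 2 := by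
      ring
    rw [this, hc2]
    field_simp
    ring
  simp_rw [h1]
  rw [lintegral_lintegral_swap]
  swap
  · apply Measurable.aemeasurable
    apply Measurable.ennreal_ofReal
    apply Real.measurable_exp.comp
    simp only [dotProduct, Finset.sum_apply, Pi.smul_apply, smul_eq_mul]
    fun_prop
  simp_rw [lintegral_exp_dotProduct_noise hσ.le]
  have h2 : ∀ h : Fin r → ℝ,
      σ ^ 2 / 2 * ((∑ i, h i • (c • b i)) ⬝ᵥ (∑ i, h i • (c • b i))) = ∑ i, h i ^ 2 / 4 := by
    intro h
    rw [sum_dotProduct, Finset.mul_sum]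
    refine Finset.sum_congr rfl fun i _ => ?_
    rw [dotProduct_sum, Finset.sum_eq_single i]
    · simp only [smul_dotProduct, dotProduct_smul, hb, smul_eq_mul, if_true]
      have : σ ^ 2 / 2 * (h i * (c * (h i * (c * 1)))) = σ ^ 2 / 2 * c ^ 2 * h i ^ 2 := by ring
      rw [this, hc2]
      field_simp
      ring
    · intro j _ hj
      simp [smul_dotProduct, dotProduct_smul, hb, hj.symm]
    · simp
  simp_rw [h2, Real.exp_sum]
  rw [lintegral_noise_prod (f := fun _ x => Real.exp (x ^ 2 / 4))
    (fun i x => (Real.exp_pos _).le)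
    (fun i => by simpa using integral_exp_sq_div_four_gaussianReal.1)]
  apply ENNReal.ofReal_le_ofReal
  have h3 : ∫ x, Real.exp (x ^ 2 / 4) ∂gaussianReal 0 ((1:ℝ).toNNReal ^ 2) = √2 := by
    simpa using integral_exp_sq_div_four_gaussianReal.2
  simp only [h3, Finset.prod_const, Finset.card_univ, Fintype.card_fin]
  have h4 : √2 ≤ Real.exp (1 / 2) := by
    rw [Real.sqrt_le_left (Real.exp_pos _).le, ← Real.exp_nat_mul]
    have := Real.add_one_le_exp (1:ℝ)
    norm_num at this ⊢
    exact this
  calc √2 ^ r ≤ Real.exp (1 / 2) ^ r := by gcongr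
    _ = Real.exp (r / 2) := by rw [← Real.exp_nat_mul]; congr 1; ring

/-! ### Maurey's empirical method for the image of an `ℓ₁` ball -/

/-- One step of the greedy empirical method: moving from `v` towards one of the atoms increases
the quadratic objective by at most a second order term. -/
theorem exists_atom_step {N : ℕ} {α : Type*} [Fintype α] {p : α → Fin N → ℝ} {w : α → ℝ}
    (hw : ∀ a, 0 ≤ w a) (hs : ∑ a, w a = 1) {B : ℝ} (hp : ∀ a, p a ⬝ᵥ p a ≤ B)
    (ξ v : Fin N → ℝ) (δ : ℝ) :
    ∃ a, ((v + δ • (p a - ∑ b, w b • p b)) ⬝ᵥ (v + δ • (p a - ∑ b, w b • p b))) / 2 -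
        2 * ((v + δ • (p a - ∑ b, w b • p b)) ⬝ᵥ ξ) ≤
      (v ⬝ᵥ v) / 2 - 2 * (v ⬝ᵥ ξ) + δ ^ 2 * B / 2 := by
  set z : Fin N → ℝ := ∑ b, w b • p b with hz
  by_contra! hcon
  have hlin : ∀ q : Fin N → ℝ, ∑ a, w a * (q ⬝ᵥ p a) = q ⬝ᵥ z := fun q => by
    rw [hz, dotProduct_sum]
    simp [dotProduct_smul]
  have hzz : 0 ≤ z ⬝ᵥ z := by
    rw [dotProduct]; exact Finset.sum_nonneg fun i _ => mul_self_nonneg _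
  have hexp : ∀ a, ((v + δ • (p a - z)) ⬝ᵥ (v + δ • (p a - z))) / 2 -
        2 * ((v + δ • (p a - z)) ⬝ᵥ ξ) =
      ((v ⬝ᵥ v) / 2 - 2 * (v ⬝ᵥ ξ)) + δ * (v ⬝ᵥ p a - v ⬝ᵥ z) - 2 * δ * (ξ ⬝ᵥ p a - ξ ⬝ᵥ z)
        + δ ^ 2 / 2 * (p a ⬝ᵥ p a - 2 * (z ⬝ᵥ p a) + z ⬝ᵥ z) := fun a => by
    simp only [add_dotProduct, dotProduct_add, smul_dotProduct, dotProduct_smul, sub_dotProduct,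
      dotProduct_sub, smul_eq_mul]
    rw [dotProduct_comm (p a) v, dotProduct_comm z v, dotProduct_comm (p a) ξ,
      dotProduct_comm z ξ, dotProduct_comm (p a) z]
    ring
  set c : ℝ := (v ⬝ᵥ v) / 2 - 2 * (v ⬝ᵥ ξ) with hc
  have hsum : ∑ a, w a * (c + δ ^ 2 * B / 2) < ∑ a, w a *
      (c + δ * (v ⬝ᵥ p a - v ⬝ᵥ z) - 2 * δ * (ξ ⬝ᵥ p a - ξ ⬝ᵥ z)
        + δ ^ 2 / 2 * (p a ⬝ᵥ p a - 2 * (z ⬝ᵥ p a) + z ⬝ᵥ z)) := by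
    refine Finset.sum_lt_sum (fun a _ => ?_) ?_
    · have := hcon a
      rw [hexp a] at this
      exact mul_le_mul_of_nonneg_left this.le (hw a)
    · obtain ⟨a, ha⟩ : ∃ a, 0 < w a := by
        by_contra! h
        have : ∑ a, w a ≤ 0 := Finset.sum_nonpos fun a _ => h a
        linarith
      refine ⟨a, Finset.mem_univ _, ?_⟩
      have := hcon a
      rw [hexp a] at this
      exact mul_lt_mul_of_pos_left this ha
  have hle : ∑ a, w a *
      (c + δ * (v ⬝ᵥ p a - v ⬝ᵥ z) - 2 * δ * (ξ ⬝ᵥ p a - ξ ⬝ᵥ z)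
        + δ ^ 2 / 2 * (p a ⬝ᵥ p a - 2 * (z ⬝ᵥ p a) + z ⬝ᵥ z)) ≤
      ∑ a, ((c - δ * (v ⬝ᵥ z) + 2 * δ * (ξ ⬝ᵥ z) + δ ^ 2 / 2 * (B + z ⬝ᵥ z)) * w a +
        δ * (w a * (v ⬝ᵥ p a)) - 2 * δ * (w a * (ξ ⬝ᵥ p a))
          - δ ^ 2 * (w a * (z ⬝ᵥ p a))) := by
    refine Finset.sum_le_sum fun a _ => ?_
    have : w a * (δ ^ 2 / 2) * (p a ⬝ᵥ p a) ≤ w a * (δ ^ 2 / 2) * B :=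
      mul_le_mul_of_nonneg_left (hp a) (mul_nonneg (hw a) (by positivity))
    linarith
  -- In the `w`-average the first-order terms cancel because the atoms have mean `z`; the
  -- second-order term is at most `δ²(B - |z|²)/2`. So not every atom can exceed the bound.
  rw [Finset.sum_sub_distrib, Finset.sum_sub_distrib, Finset.sum_add_distrib, ← Finset.mul_sum,
    ← Finset.mul_sum, ← Finset.mul_sum, ← Finset.mul_sum, hlin, hlin, hlin, hs] at hle
  rw [← Finset.sum_mul, hs] at hsum
  nlinarith [mul_nonneg (sq_nonneg δ) hzz]

/-- The empirical method of Maurey, derandomized: some average of `k` atoms has nearly as small a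
quadratic objective as the given convex combination. -/
theorem exists_sym_average {N : ℕ} {α : Type*} [Fintype α] {p : α → Fin N → ℝ} {w : α → ℝ}
    (hw : ∀ a, 0 ≤ w a) (hs : ∑ a, w a = 1) {B : ℝ} (hp : ∀ a, p a ⬝ᵥ p a ≤ B)
    (ξ : Fin N → ℝ) {k : ℕ} (hk : 0 < k) :
    ∃ m : Sym α k,
      (((k : ℝ)⁻¹ • ((m : Multiset α).map p).sum) ⬝ᵥ
          ((k : ℝ)⁻¹ • ((m : Multiset α).map p).sum)) / 2 -
        2 * (((k : ℝ)⁻¹ • ((m : Multiset α).map p).sum) ⬝ᵥ ξ) ≤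
      ((∑ a, w a • p a) ⬝ᵥ (∑ a, w a • p a)) / 2 - 2 * ((∑ a, w a • p a) ⬝ᵥ ξ)
        + B / (2 * k) := by
  set z : Fin N → ℝ := ∑ b, w b • p b with hz
  have hk' : (k : ℝ) ≠ 0 := by positivity
  -- Start from `z` and replace one `k`-th of it at a time by an atom; each replacement costs
  -- `B/(2k²)`, and after `k` of them no `z` is left.
  have key : ∀ j : ℕ, ∃ m : Multiset α, m.card = j ∧
      ((z + (k : ℝ)⁻¹ • ((m.map p).sum - (j : ℝ) • z)) ⬝ᵥ
        (z + (k : ℝ)⁻¹ • ((m.map p).sum - (j : ℝ) • z))) / 2 -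
        2 * ((z + (k : ℝ)⁻¹ • ((m.map p).sum - (j : ℝ) • z)) ⬝ᵥ ξ) ≤
      (z ⬝ᵥ z) / 2 - 2 * (z ⬝ᵥ ξ) + j * ((k : ℝ)⁻¹ ^ 2 * B / 2) := by
    intro j
    induction j with
    | zero => exact ⟨0, by simp⟩
    | succ j ih =>
      obtain ⟨m, hm, h⟩ := ih
      obtain ⟨a, ha⟩ := exists_atom_step hw hs hp ξ
        (z + (k : ℝ)⁻¹ • ((m.map p).sum - (j : ℝ) • z)) (k : ℝ)⁻¹
      refine ⟨a ::ₘ m, by simp [hm], ?_⟩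
      have e : z + (k : ℝ)⁻¹ • (((a ::ₘ m).map p).sum - ((j + 1 : ℕ) : ℝ) • z) =
          z + (k : ℝ)⁻¹ • ((m.map p).sum - (j : ℝ) • z) + (k : ℝ)⁻¹ • (p a - z) := by
        rw [Multiset.map_cons, Multiset.sum_cons]
        push_cast
        module
      rw [e]
      push_cast
      linarith
  obtain ⟨m, hm, h⟩ := key k
  refine ⟨⟨m, hm⟩, ?_⟩
  have e : z + (k : ℝ)⁻¹ • ((m.map p).sum - (k : ℝ) • z) = (k : ℝ)⁻¹ • (m.map p).sum := by
    rw [smul_sub, smul_smul, inv_mul_cancel₀ hk', one_smul]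
    abel
  rw [e] at h
  refine h.trans (le_of_eq ?_)
  congr 1
  field_simp

noncomputable section

/-- The vertices of `X (y B₁)`, together with its centre. -/
def ballAtom {N d : ℕ} (X : Matrix (Fin N) (Fin d) ℝ) (y : ℝ) :
    Option (Fin d × Bool) → Fin N → ℝ
  | none => 0
  | some (j, true) => y • X.col j
  | some (j, false) => -(y • X.col j)

/-- The averages of `k` vertices of `X (y B₁)`. -/
def ballAverage {N d : ℕ} (X : Matrix (Fin N) (Fin d) ℝ) (y : ℝ) {k : ℕ}
    (m : Sym (Option (Fin d × Bool)) k) : Fin N → ℝ :=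
  (k : ℝ)⁻¹ • ((m : Multiset (Option (Fin d × Bool))).map (ballAtom X y)).sum

end

theorem ballAtom_dotProduct_self_le {N d : ℕ} {X : Matrix (Fin N) (Fin d) ℝ} {K : ℝ}
    (hK : ∀ j, X.col j ⬝ᵥ X.col j ≤ K) (hK0 : 0 ≤ K) (y : ℝ) (a : Option (Fin d × Bool)) :
    ballAtom X y a ⬝ᵥ ballAtom X y a ≤ y ^ 2 * K := by
  have h : ∀ j, (y • X.col j) ⬝ᵥ (y • X.col j) ≤ y ^ 2 * K := fun j => by
    rw [smul_dotProduct, dotProduct_smul, smul_eq_mul, smul_eq_mul, ← mul_assoc, ← sq]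
    exact mul_le_mul_of_nonneg_left (hK j) (sq_nonneg y)
  rcases a with _ | ⟨j, _ | _⟩
  · simp only [ballAtom, zero_dotProduct]; positivity
  · simpa only [ballAtom, neg_dotProduct_neg] using h j
  · exact h j

/-- Every point of `X (y B₁)` is a convex combination of the atoms. -/
theorem exists_weights_ballAtom {N d : ℕ} (X : Matrix (Fin N) (Fin d) ℝ) {y : ℝ} (hy : 0 < y)
    {u : Fin d → ℝ} (hu : l1 u ≤ y) :
    ∃ w : Option (Fin d × Bool) → ℝ, (∀ a, 0 ≤ w a) ∧ ∑ a, w a = 1 ∧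
      ∑ a, w a • ballAtom X y a = X.mulVec u := by
  -- The centre takes the mass missing when `‖u‖₁ < y`.
  let w : Option (Fin d × Bool) → ℝ
    | none => 1 - l1 u / y
    | some (j, true) => (u j)⁺ / y
    | some (j, false) => (u j)⁻ / y
  refine ⟨w, ?_, ?_, ?_⟩
  · rintro (_ | ⟨j, _ | _⟩)
    · exact sub_nonneg.2 ((div_le_one hy).2 hu)
    · exact div_nonneg (negPart_nonneg _) hy.le
    · exact div_nonneg (posPart_nonneg _) hy.le
  · simp only [Fintype.sum_option, Fintype.sum_prod_type, Fintype.sum_bool, w, ← add_div,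
      posPart_add_negPart]
    rw [← Finset.sum_div]
    simp [l1]
  · simp only [Fintype.sum_option, Fintype.sum_prod_type, Fintype.sum_bool, w, ballAtom]
    rw [smul_zero, zero_add, Matrix.mulVec_eq_sum]
    refine Finset.sum_congr rfl fun j _ => ?_
    have h1 : ((u j)⁺ / y) • (y • X.col j) + ((u j)⁻ / y) • -(y • X.col j) =
        ((u j)⁺ - (u j)⁻) • X.col j := by
      rw [smul_neg, smul_smul, smul_smul, div_mul_cancel₀ _ hy.ne', div_mul_cancel₀ _ hy.ne',
        sub_smul, sub_eq_add_neg]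
    rw [h1, posPart_sub_negPart]
    ext i
    simp [Matrix.col, mul_comm]

/-- A bound at the averages of `k` vertices extends to all of `X (y B₁)`. -/
theorem dotProduct_le_of_ballAverage {N d : ℕ} {X : Matrix (Fin N) (Fin d) ℝ} {K : ℝ}
    (hK : ∀ j, X.col j ⬝ᵥ X.col j ≤ K) (hK0 : 0 ≤ K) {y : ℝ} (hy : 0 < y) {k : ℕ} (hk : 0 < k)
    {D : ℝ} {ξ : Fin N → ℝ}
    (h : ∀ m : Sym (Option (Fin d × Bool)) k,
      2 * (ballAverage X y m ⬝ᵥ ξ) ≤ (ballAverage X y m ⬝ᵥ ballAverage X y m) / 2 + D)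
    {u : Fin d → ℝ} (hu : l1 u ≤ y) :
    2 * (X.mulVec u ⬝ᵥ ξ) ≤ (X.mulVec u ⬝ᵥ X.mulVec u) / 2 + D + y ^ 2 * K / (2 * k) := by
  obtain ⟨w, hw, hs, hz⟩ := exists_weights_ballAtom X hy hu
  obtain ⟨m, hm⟩ := exists_sym_average hw hs (ballAtom_dotProduct_self_le hK hK0 y) ξ hk
  rw [hz] at hm
  have := h m
  unfold ballAverage at this
  linarith

/-! ### Uniform bounds over the averages and over the range of the design -/

/-- Averages do not depend on order; counting multisets instead of tuples gains the `k!` that turns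
`k log d` into `k log(ed/k)`. The factor `3ᵏ` is absorbed because `log(ed/k) ≥ 1` for `k ≤ d`. -/
theorem card_sym_option_le_exp {d k : ℕ} (hk : 0 < k) (hkd : k ≤ d) :
    (Fintype.card (Sym (Option (Fin d × Bool)) k) : ℝ) ≤
      Real.exp (3 * k * Real.log (Real.exp 1 * d / k)) := by
  have hk' : (0 : ℝ) < k := by exact_mod_cast hk
  have hkd' : (k : ℝ) ≤ d := by exact_mod_cast hkd
  have hd' : (0 : ℝ) < d := hk'.trans_le hkd'
  have hL : 1 ≤ Real.log (Real.exp 1 * d / k) := by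
    rw [Real.le_log_iff_exp_le (by positivity), le_div_iff₀ hk']
    gcongr
  rw [Sym.card_sym_eq_choose]
  have hc : Fintype.card (Option (Fin d × Bool)) = 2 * d + 1 := by simp [mul_comm]
  rw [hc]
  have h1 : ((2 * d + 1 + k - 1).choose k : ℝ) ≤ ((3 * d : ℕ) : ℝ) ^ k / k.factorial :=
    (Nat.cast_le.2 (Nat.choose_le_choose k (by omega))).trans (Nat.choose_le_pow_div k (3 * d))
  have h2 : (k : ℝ) ^ k / k.factorial ≤ Real.exp k := Real.pow_div_factorial_le_exp _ hk'.le k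
  have h3 : ((3 * d : ℕ) : ℝ) ^ k / k.factorial =
      (3 * d / k) ^ k * ((k : ℝ) ^ k / k.factorial) := by
    rw [div_pow]; push_cast; field_simp
  have h4 : (3 * (d : ℝ) / k) ^ k * Real.exp k = (3 * (Real.exp 1 * d / k)) ^ k := by
    have : Real.exp k = Real.exp 1 ^ k := by rw [← Real.exp_nat_mul, mul_one]
    rw [this, ← mul_pow]
    congr 1
    ring
  have h5 : (3 : ℝ) ≤ Real.exp 2 := by have := Real.add_one_le_exp (2:ℝ); linarith
  calc ((2 * d + 1 + k - 1).choose k : ℝ) ≤ (3 * d / k) ^ k * ((k : ℝ) ^ k / k.factorial) :=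
        h1.trans h3.le
    _ ≤ (3 * d / k) ^ k * Real.exp k := by gcongr
    _ = (3 * (Real.exp 1 * d / k)) ^ k := h4
    _ ≤ (Real.exp (3 * Real.log (Real.exp 1 * d / k))) ^ k := by
        gcongr
        calc 3 * (Real.exp 1 * d / k) ≤ Real.exp 2 * Real.exp (Real.log (Real.exp 1 * d / k)) := by
              rw [Real.exp_log (by positivity)]; gcongr
          _ = Real.exp (2 + Real.log (Real.exp 1 * d / k)) := (Real.exp_add _ _).symm
          _ ≤ _ := Real.exp_le_exp.2 (by linarith)
    _ = _ := by rw [← Real.exp_nat_mul]; congr 1; ring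

/-- The uniform bound over the averages of `k` vertices. -/
theorem noise_exists_ballAverage_le {N d : ℕ} {σ : ℝ} (hσ : 0 < σ)
    (X : Matrix (Fin N) (Fin d) ℝ) (y : ℝ) {k : ℕ} (hk : 0 < k) (hkd : k ≤ d) (s : ℝ) :
    noise N σ {ξ | ∃ m : Sym (Option (Fin d × Bool)) k,
      (ballAverage X y m ⬝ᵥ ballAverage X y m) / 2 +
        4 * σ ^ 2 * (3 * k * Real.log (Real.exp 1 * d / k) + s) < 2 * (ballAverage X y m ⬝ᵥ ξ)} ≤
      ENNReal.ofReal (Real.exp (-s)) := by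
  set L := 3 * k * Real.log (Real.exp 1 * d / k) with hL
  calc _ = noise N σ (⋃ m : Sym (Option (Fin d × Bool)) k,
        {ξ | (ballAverage X y m ⬝ᵥ ballAverage X y m) / 2 + 4 * σ ^ 2 * (L + s) <
          2 * (ballAverage X y m ⬝ᵥ ξ)}) := by
        congr 1; ext ξ; simp
    _ ≤ ∑ m : Sym (Option (Fin d × Bool)) k, noise N σ
        {ξ | (ballAverage X y m ⬝ᵥ ballAverage X y m) / 2 + 4 * σ ^ 2 * (L + s) <
          2 * (ballAverage X y m ⬝ᵥ ξ)} := measure_iUnion_fintype_le _ _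
    _ ≤ ∑ _m : Sym (Option (Fin d × Bool)) k, ENNReal.ofReal (Real.exp (-(L + s))) :=
        Finset.sum_le_sum fun m _ => noise_dotProduct_tail hσ _ _
    _ = ENNReal.ofReal (Fintype.card (Sym (Option (Fin d × Bool)) k) * Real.exp (-(L + s))) := by
        rw [Finset.sum_const, nsmul_eq_mul, Finset.card_univ,
          ENNReal.ofReal_mul (Nat.cast_nonneg _), ENNReal.ofReal_natCast]
    _ ≤ ENNReal.ofReal (Real.exp L * Real.exp (-(L + s))) := by
        gcongr
        exact card_sym_option_le_exp hk hkd
    _ = _ := by rw [← Real.exp_add]; congr 2; ring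

/-- In these coordinates only `rank X` components of the noise act on the range of `X`. -/
theorem exists_orthonormal_range {N d : ℕ} (X : Matrix (Fin N) (Fin d) ℝ) :
    ∃ b : Fin X.rank → Fin N → ℝ, (∀ i j, b i ⬝ᵥ b j = if i = j then 1 else 0) ∧
      ∀ u, X.mulVec u = ∑ i, (b i ⬝ᵥ X.mulVec u) • b i := by
  let e := (WithLp.linearEquiv 2 ℝ (Fin N → ℝ)).symm
  let S : Submodule ℝ (EuclideanSpace ℝ (Fin N)) := (LinearMap.range X.mulVecLin).map e.toLinearMap
  have hS : Module.finrank ℝ S = X.rank := LinearEquiv.finrank_map_eq e _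
  let B := (stdOrthonormalBasis ℝ S).reindex (finCongr hS)
  have inner_eq : ∀ x y : EuclideanSpace ℝ (Fin N), inner ℝ x y = x.ofLp ⬝ᵥ y.ofLp := fun x y => by
    rw [EuclideanSpace.inner_eq_star_dotProduct, dotProduct_comm]; rfl
  refine ⟨fun i => (B i : EuclideanSpace ℝ (Fin N)).ofLp, fun i j => ?_, fun u => ?_⟩
  · rw [← inner_eq, ← Submodule.coe_inner]
    exact orthonormal_iff_ite.1 B.orthonormal i j
  · have hu : WithLp.toLp 2 (X.mulVec u) ∈ S := ⟨X.mulVec u, ⟨u, rfl⟩, rfl⟩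
    have h := B.sum_repr' ⟨_, hu⟩
    have h' := congrArg (fun v : S => (v : EuclideanSpace ℝ (Fin N)).ofLp) h
    simp only [Submodule.coe_inner, inner_eq] at h'
    exact h'.symm.trans (by simp)

/-- The uniform bound over the range of the design, in terms of its rank. -/
theorem noise_exists_mulVec_rank_le {N d : ℕ} {σ : ℝ} (hσ : 0 < σ)
    (X : Matrix (Fin N) (Fin d) ℝ) (s : ℝ) :
    noise N σ {ξ | ∃ u, (X.mulVec u ⬝ᵥ X.mulVec u) / 2 + σ ^ 2 * (4 * X.rank + 8 * s) <
      2 * (X.mulVec u ⬝ᵥ ξ)} ≤ ENNReal.ofReal (Real.exp (-s)) := by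
  obtain ⟨b, hb, hX⟩ := exists_orthonormal_range X
  have hm : Measurable fun ξ : Fin N → ℝ => (∑ i, (b i ⬝ᵥ ξ) ^ 2) / (4 * σ ^ 2) := by
    unfold dotProduct; fun_prop
  have h := noise_lt_le_of_lintegral_exp (D := X.rank / 2 + s) hm
    (lintegral_exp_sum_sq_noise hσ b hb)
  rw [sub_add_cancel_left] at h
  refine (measure_mono ?_).trans h
  rintro ξ ⟨u, hu⟩
  set z := X.mulVec u
  have hz' : z = ∑ i, (b i ⬝ᵥ z) • b i := hX u
  have h1 : z ⬝ᵥ ξ = ∑ i, (b i ⬝ᵥ z) * (b i ⬝ᵥ ξ) := by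
    conv_lhs => rw [hz']
    rw [sum_dotProduct]
    simp [smul_dotProduct]
  have h2 : z ⬝ᵥ z = ∑ i, (b i ⬝ᵥ z) * (b i ⬝ᵥ z) := by
    conv_lhs => enter [1]; rw [hz']
    rw [sum_dotProduct]
    simp [smul_dotProduct]
  -- Coordinatewise `2ab ≤ a²/2 + 2b²`.
  have h3 : 2 * (z ⬝ᵥ ξ) ≤ (z ⬝ᵥ z) / 2 + 2 * ∑ i, (b i ⬝ᵥ ξ) ^ 2 := by
    rw [h1, h2, Finset.mul_sum, Finset.sum_div, Finset.mul_sum, ← Finset.sum_add_distrib]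
    refine Finset.sum_le_sum fun i _ => ?_
    nlinarith [sq_nonneg (b i ⬝ᵥ z - 2 * (b i ⬝ᵥ ξ))]
  rw [Set.mem_ofPred_eq, lt_div_iff₀ (by positivity)]
  linarith

/-! ### Elementary facts on the `ℓ₁` norm and a geometric sum -/

theorem l1_nonneg {d : ℕ} (u : Fin d → ℝ) : 0 ≤ l1 u := Finset.sum_nonneg fun _ _ => abs_nonneg _

theorem l1_smul {d : ℕ} {c : ℝ} (hc : 0 ≤ c) (u : Fin d → ℝ) : l1 (c • u) = c * l1 u := by
  simp [l1, abs_mul, abs_of_nonneg hc, Finset.mul_sum]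

theorem l1_sub_le {d : ℕ} (u v : Fin d → ℝ) : l1 (u - v) ≤ l1 u + l1 v := by
  unfold l1
  rw [← Finset.sum_add_distrib]
  exact Finset.sum_le_sum fun j _ => abs_sub _ _

theorem eq_zero_of_l1_le_zero {d : ℕ} {u : Fin d → ℝ} (h : l1 u ≤ 0) : u = 0 := by
  have h0 : l1 u = 0 := le_antisymm h (l1_nonneg u)
  ext j
  simpa using (Finset.sum_eq_zero_iff_of_nonneg fun j _ => abs_nonneg (u j)).1 h0 j
    (Finset.mem_univ j)

theorem mulVec_dotProduct_self_le {N d : ℕ} {X : Matrix (Fin N) (Fin d) ℝ} {K : ℝ}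
    (hK : ∀ j, X.col j ⬝ᵥ X.col j ≤ K) (hK0 : 0 ≤ K) (u : Fin d → ℝ) :
    X.mulVec u ⬝ᵥ X.mulVec u ≤ l1 u ^ 2 * K := by
  have hn : ∀ v : Fin N → ℝ, v ⬝ᵥ v = ‖WithLp.toLp 2 v‖ ^ 2 := fun v => by
    rw [EuclideanSpace.real_norm_sq_eq, dotProduct]
    exact Finset.sum_congr rfl fun i _ => (sq _).symm
  have h1 : WithLp.toLp 2 (X.mulVec u) = ∑ j, u j • WithLp.toLp 2 (X.col j) := by
    rw [Matrix.mulVec_eq_sum]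
    ext i
    simp [Matrix.col, mul_comm]
  have h2 : ‖WithLp.toLp 2 (X.mulVec u)‖ ≤ l1 u * √K := by
    rw [h1, l1, Finset.sum_mul]
    refine (norm_sum_le _ _).trans (Finset.sum_le_sum fun j _ => ?_)
    rw [norm_smul, Real.norm_eq_abs]
    gcongr
    apply Real.le_sqrt_of_sq_le
    rw [← hn]
    exact hK j
  rw [hn]
  calc _ ≤ (l1 u * √K) ^ 2 := by gcongr
    _ = _ := by rw [mul_pow, Real.sq_sqrt hK0]

/-- Sums the failure probabilities of the levels: level `k` is given the extra deviation `k`. -/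
theorem sum_range_exp_neg_le (d : ℕ) : ∑ k ∈ Finset.range d, Real.exp (-((k : ℝ) + 1)) ≤ 1 := by
  have h : ∀ k : ℕ, Real.exp (-((k : ℝ) + 1)) ≤ (1 / 2) ^ (k + 1) := fun k => by
    have e : Real.exp (-((k : ℝ) + 1)) = Real.exp (-1) ^ (k + 1) := by
      rw [← Real.exp_nat_mul]; push_cast; congr 1; ring
    rw [e]
    gcongr
    rw [Real.exp_neg, ← one_div]
    gcongr
    have := Real.add_one_le_exp (1 : ℝ)
    linarith
  have h2 : ∀ d : ℕ, ∑ k ∈ Finset.range d, (1 / 2 : ℝ) ^ (k + 1) = 1 - (1 / 2) ^ d := by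
    intro d
    induction d with
    | zero => simp
    | succ d ih => rw [Finset.sum_range_succ, ih]; ring
  calc _ ≤ ∑ k ∈ Finset.range d, (1 / 2 : ℝ) ^ (k + 1) := Finset.sum_le_sum fun k _ => h k
    _ = 1 - (1 / 2) ^ d := h2 d
    _ ≤ 1 := by linarith [pow_pos (show (0 : ℝ) < 1 / 2 by norm_num) d]

/-! ### The good event: all levels at once -/

noncomputable section

/-- The logarithmic factor `log (ed / k)`. -/
def logFactor (d : ℕ) (x : ℝ) : ℝ := Real.log (Real.exp 1 * d / x)

/-- The `ℓ₁` radius at which averages of `k` vertices are the right approximation. -/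
def levelRadius (N d : ℕ) (σ : ℝ) (k : ℕ) : ℝ := k * √(logFactor d k) * σ / √N

end

theorem one_le_logFactor {d : ℕ} {x : ℝ} (hx : 0 < x) (hxd : x ≤ d) : 1 ≤ logFactor d x := by
  have hd : (0 : ℝ) < d := hx.trans_le hxd
  rw [logFactor, Real.le_log_iff_exp_le (by positivity), le_div_iff₀ hx]
  gcongr

/-- The noise vectors for which the bound through the rank and the bounds at all levels hold. -/
structure IsGoodNoise {N d : ℕ} (X : Matrix (Fin N) (Fin d) ℝ) (σ s : ℝ) (ξ : Fin N → ℝ) :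
    Prop where
  rank_bound : ∀ u, 2 * (X.mulVec u ⬝ᵥ ξ) ≤
    (X.mulVec u ⬝ᵥ X.mulVec u) / 2 + σ ^ 2 * (4 * X.rank + 8 * s)
  level_bound : ∀ k : ℕ, 0 < k → k ≤ d → ∀ u, l1 u ≤ levelRadius N d σ k →
    2 * (X.mulVec u ⬝ᵥ ξ) ≤
      (X.mulVec u ⬝ᵥ X.mulVec u) / 2 + σ ^ 2 * (18 * (k * logFactor d k) + 4 * s)

theorem noise_not_isGoodNoise_le {N d : ℕ} (hN : 0 < N) {σ : ℝ} (hσ : 0 < σ)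
    {X : Matrix (Fin N) (Fin d) ℝ} (hX : ∀ j, X.col j ⬝ᵥ X.col j ≤ 9 / 4 * N) (s : ℝ) :
    noise N σ {ξ | ¬ IsGoodNoise X σ s ξ} ≤ ENNReal.ofReal (2 * Real.exp (-s)) := by
  have hN' : (0 : ℝ) < N := by exact_mod_cast hN
  set A : Set (Fin N → ℝ) := {ξ | ∃ u, (X.mulVec u ⬝ᵥ X.mulVec u) / 2 +
    σ ^ 2 * (4 * X.rank + 8 * s) < 2 * (X.mulVec u ⬝ᵥ ξ)} with hA
  -- `E k` is failure at level `k + 1`, with deviation `s + (k + 1)` to make the union over levels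
  -- summable.
  set E : ℕ → Set (Fin N → ℝ) := fun k => {ξ | ∃ m : Sym (Option (Fin d × Bool)) (k + 1),
      (ballAverage X (levelRadius N d σ (k + 1)) m ⬝ᵥ
        ballAverage X (levelRadius N d σ (k + 1)) m) / 2 +
        4 * σ ^ 2 * (3 * (k + 1 : ℕ) * Real.log (Real.exp 1 * d / (k + 1 : ℕ)) +
          (s + ((k : ℝ) + 1))) <
        2 * (ballAverage X (levelRadius N d σ (k + 1)) m ⬝ᵥ ξ)} with hE
  have hsub : {ξ | ¬ IsGoodNoise X σ s ξ} ⊆ A ∪ ⋃ k ∈ Finset.range d, E k := by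
    intro ξ hξ
    by_contra hcon
    simp only [Set.mem_union, Set.mem_iUnion, not_or, not_exists, Finset.mem_range] at hcon
    refine hξ ⟨fun u => ?_, fun k hk hkd u hu => ?_⟩
    · by_contra! h
      exact hcon.1 ⟨u, h⟩
    · obtain ⟨k, rfl⟩ : ∃ j, k = j + 1 := ⟨k - 1, by omega⟩
      have hk' : (0 : ℝ) < (k + 1 : ℕ) := by positivity
      have hL := one_le_logFactor hk' (by exact_mod_cast hkd : ((k + 1 : ℕ) : ℝ) ≤ d)
      have hy : 0 < levelRadius N d σ (k + 1) := by
        unfold levelRadius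
        have : 0 < √(logFactor d (k + 1 : ℕ)) := Real.sqrt_pos.2 (by linarith)
        positivity
      have h1 : ∀ m : Sym (Option (Fin d × Bool)) (k + 1), _ := fun m =>
        not_lt.1 fun h => hcon.2 k hkd ⟨m, h⟩
      have h2 := dotProduct_le_of_ballAverage hX (by positivity) hy k.succ_pos h1 hu
      -- At the level radius the Maurey error is `9/8 · σ²k log(ed/k)`, comparable to the entropy
      -- term. With `12` from the entropy and at most `4` from the extra deviation this stays below
      -- `18`.
      have h3 : levelRadius N d σ (k + 1) ^ 2 * (9 / 4 * N) / (2 * (k + 1 : ℕ)) =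
          σ ^ 2 * (9 / 8 * ((k + 1 : ℕ) * logFactor d (k + 1 : ℕ))) := by
        unfold levelRadius
        rw [div_pow, mul_pow, mul_pow, Real.sq_sqrt (by linarith), Real.sq_sqrt hN'.le]
        field_simp
        norm_num
      rw [h3] at h2
      have h4 : ((k + 1 : ℕ) : ℝ) ≤ (k + 1 : ℕ) * logFactor d (k + 1 : ℕ) :=
        le_mul_of_one_le_right hk'.le hL
      have e : Real.log (Real.exp 1 * d / (k + 1 : ℕ)) = logFactor d (k + 1 : ℕ) := rfl
      rw [e] at h2
      have hcast : (k : ℝ) + 1 = (k + 1 : ℕ) := by push_cast; rfl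
      rw [hcast] at h2
      refine h2.trans ?_
      set Q := ((k + 1 : ℕ) : ℝ) * logFactor d (k + 1 : ℕ) with hQ
      have h5 : 4 * σ ^ 2 * (3 * ((k + 1 : ℕ) : ℝ) * logFactor d (k + 1 : ℕ) +
          (s + (k + 1 : ℕ))) = σ ^ 2 * (12 * Q + 4 * s + 4 * (k + 1 : ℕ)) := by rw [hQ]; ring
      rw [h5, add_assoc, ← mul_add]
      exact add_le_add le_rfl (mul_le_mul_of_nonneg_left (by linarith) (sq_nonneg σ))
  calc _ ≤ noise N σ (A ∪ ⋃ k ∈ Finset.range d, E k) := measure_mono hsub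
    _ ≤ noise N σ A + ∑ k ∈ Finset.range d, noise N σ (E k) :=
        (measure_union_le _ _).trans (add_le_add le_rfl (measure_biUnion_finset_le _ _))
    _ ≤ ENNReal.ofReal (Real.exp (-s)) +
        ∑ k ∈ Finset.range d, ENNReal.ofReal (Real.exp (-(s + ((k : ℝ) + 1)))) := by
        refine add_le_add (noise_exists_mulVec_rank_le hσ X s) (Finset.sum_le_sum fun k hk => ?_)
        exact noise_exists_ballAverage_le hσ X _ k.succ_pos (Finset.mem_range.1 hk) _
    _ = ENNReal.ofReal (Real.exp (-s) +
        Real.exp (-s) * ∑ k ∈ Finset.range d, Real.exp (-((k : ℝ) + 1))) := by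
        rw [← ENNReal.ofReal_sum_of_nonneg (fun k _ => (Real.exp_pos _).le),
          ← ENNReal.ofReal_add (Real.exp_pos _).le
            (Finset.sum_nonneg fun k _ => (Real.exp_pos _).le), Finset.mul_sum]
        congr 2
        refine Finset.sum_congr rfl fun k _ => ?_
        rw [← Real.exp_add]
        congr 1
        ring
    _ ≤ _ := by
        apply ENNReal.ofReal_le_ofReal
        nlinarith [sum_range_exp_neg_le d, Real.exp_pos (-s)]

/-! ### From levels to the rate at an arbitrary radius -/

/-- The rate in the normalized radius `x = ρ √N / σ`. -/
theorem rate_eq_normalized {N d : ℕ} (hN : 0 < N) {σ : ℝ} (hσ : 0 < σ)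
    (X : Matrix (Fin N) (Fin d) ℝ) (ρ : ℝ) :
    N * rate X σ ρ = σ ^ 2 * min (X.rank : ℝ)
      (min (ρ * √N / σ * √(max 1 (logFactor d (ρ * √N / σ)))) (ρ * √N / σ * √(logFactor d 1))) := by
  have hN' : (0 : ℝ) < N := by exact_mod_cast hN
  have hn : 0 < √(N : ℝ) := Real.sqrt_pos.2 hN'
  have hn2 : √(N : ℝ) * √N = N := Real.mul_self_sqrt hN'.le
  have e1 : (N : ℝ) * (σ ^ 2 * X.rank / N) = σ ^ 2 * X.rank := by field_simp
  have e2 : ∀ t : ℝ, (N : ℝ) * (ρ * σ * √(t / N)) = σ ^ 2 * (ρ * √N / σ * √t) := fun t => by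
    rw [Real.sqrt_div' _ hN'.le]
    field_simp
    rw [sq, hn2]
    ring
  have e3 : Real.exp 1 * σ * d / (ρ * √N) = Real.exp 1 * d / (ρ * √N / σ) := by
    rw [div_div_eq_mul_div]; ring
  rw [rate, midTerm, mul_min_of_nonneg _ _ hN'.le, mul_min_of_nonneg _ _ hN'.le, e1, e2, e2,
    mul_min_of_nonneg _ _ (sq_nonneg σ), mul_min_of_nonneg _ _ (sq_nonneg σ), e3]
  simp only [logFactor, div_one]

theorem half_le_sub_half_log {L : ℝ} (hL : 1 ≤ L) : L / 2 ≤ L - Real.log L / 2 := by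
  have := Real.log_le_sub_one_of_pos (by linarith : 0 < L)
  linarith

/-- For radii below the `k`-th level radius, the two logarithmic factors are comparable. -/
theorem half_logFactor_le {d k : ℕ} (hk : 0 < k) (hkd : k ≤ d) {x : ℝ} (hx : 0 < x)
    (hxk : x ≤ k * √(logFactor d k)) : logFactor d k / 2 ≤ logFactor d x := by
  have hk' : (0 : ℝ) < k := by exact_mod_cast hk
  have hkd' : (k : ℝ) ≤ d := by exact_mod_cast hkd
  have hd : (0 : ℝ) < d := hk'.trans_le hkd'
  have hL := one_le_logFactor hk' hkd'
  have h1 : Real.log x ≤ Real.log k + Real.log (logFactor d k) / 2 := by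
    rw [← Real.log_sqrt (by linarith), ← Real.log_mul hk'.ne' (Real.sqrt_pos.2 (by linarith)).ne']
    exact Real.log_le_log hx hxk
  have h2 : logFactor d k = Real.log (Real.exp 1 * d) - Real.log k :=
    Real.log_div (by positivity) hk'.ne'
  have h3 : logFactor d x = Real.log (Real.exp 1 * d) - Real.log x :=
    Real.log_div (by positivity) hx.ne'
  have := half_le_sub_half_log hL
  linarith

/-- `17/12` is a rational upper bound for `√2`; the final constant is `18 · 2 · 17/12 = 51`. -/
theorem sqrt_le_mul_sqrt_half {L : ℝ} (hL : 0 ≤ L) : √L ≤ 17 / 12 * √(L / 2) := by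
  rw [Real.sqrt_le_left (by positivity), mul_pow, Real.sq_sqrt (by positivity)]
  linarith

/-- The bound in the normalized radius. -/
theorem IsGoodNoise.dotProduct_le_normalized {N d : ℕ} (hN : 0 < N) {σ s : ℝ} (hσ : 0 < σ)
    (hs : 0 ≤ s) {X : Matrix (Fin N) (Fin d) ℝ} (hX : ∀ j, X.col j ⬝ᵥ X.col j ≤ 9 / 4 * N)
    {ξ : Fin N → ℝ} (h : IsGoodNoise X σ s ξ) {x : ℝ} (hx : 0 < x)
    {u : Fin d → ℝ} (hu : l1 u ≤ x * σ / √N) :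
    2 * (X.mulVec u ⬝ᵥ ξ) ≤ (X.mulVec u ⬝ᵥ X.mulVec u) / 2 + σ ^ 2 * (51 *
      (min (X.rank : ℝ) (min (x * √(max 1 (logFactor d x))) (x * √(logFactor d 1))) + s)) := by
  have hN' : (0 : ℝ) < N := by exact_mod_cast hN
  have hn : 0 < √(N : ℝ) := Real.sqrt_pos.2 hN'
  have weaken : ∀ {a b : ℝ}, 2 * (X.mulVec u ⬝ᵥ ξ) ≤
      (X.mulVec u ⬝ᵥ X.mulVec u) / 2 + σ ^ 2 * a → a ≤ b →
      2 * (X.mulVec u ⬝ᵥ ξ) ≤ (X.mulVec u ⬝ᵥ X.mulVec u) / 2 + σ ^ 2 * b := fun h1 h2 =>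
    h1.trans (add_le_add le_rfl (mul_le_mul_of_nonneg_left h2 (sq_nonneg σ)))
  rcases le_or_gt (X.rank : ℝ) (min (x * √(max 1 (logFactor d x))) (x * √(logFactor d 1)))
    with hr | hr
  · rw [min_eq_left hr]
    exact weaken (h.rank_bound u) (by linarith [(Nat.cast_nonneg X.rank : (0 : ℝ) ≤ _)])
  rw [min_eq_right hr.le]
  have hrd : (X.rank : ℝ) ≤ d := by exact_mod_cast X.rank_le_width
  have hd1 : 1 ≤ d := by
    have : 0 < X.rank := by
      have : (0 : ℝ) < X.rank := lt_of_le_of_lt (by positivity) hr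
      exact_mod_cast this
    exact this.trans_le X.rank_le_width
  have hL1 : 1 ≤ logFactor d 1 := one_le_logFactor one_pos (by exact_mod_cast hd1)
  -- Here the rank exceeds the other two terms, hence `x ≤ rank X ≤ d`, so that some level `k ≤ d`
  -- reaches `x`.
  have hxd : x ≤ d := by
    refine le_trans ?_ (hr.le.trans hrd)
    refine le_min ?_ ?_ <;> refine le_mul_of_one_le_right hx.le (Real.one_le_sqrt.2 ?_)
    · exact le_max_left _ _
    · exact hL1
  set M := min (x * √(max 1 (logFactor d x))) (x * √(logFactor d 1)) with hM
  have hM0 : 0 ≤ M := le_min (by positivity) (by positivity)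
  have hlow : ∀ k : ℕ, 0 < k → k ≤ d → x ≤ k * √(logFactor d k) →
      x * √(logFactor d k) ≤ 17 / 12 * M := fun k hk hkd hxk => by
    have hk' : (1 : ℝ) ≤ k := by exact_mod_cast hk
    have hkd' : (k : ℝ) ≤ d := by exact_mod_cast hkd
    have hL := one_le_logFactor (by linarith) hkd'
    have hmono : logFactor d k ≤ logFactor d 1 := by
      unfold logFactor
      have : (0 : ℝ) < d := by linarith
      exact Real.log_le_log (by positivity) (by gcongr)
    have h1 : x * √(logFactor d k / 2) ≤ M := by
      refine le_min ?_ ?_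
      · gcongr
        exact (half_logFactor_le hk hkd hx hxk).trans (le_max_right _ _)
      · gcongr
        linarith
    calc _ ≤ x * (17 / 12 * √(logFactor d k / 2)) := by
          gcongr; exact sqrt_le_mul_sqrt_half (by linarith)
      _ = 17 / 12 * (x * √(logFactor d k / 2)) := by ring
      _ ≤ _ := by gcongr
  have hlev : ∀ k : ℕ, x ≤ k * √(logFactor d k) → l1 u ≤ levelRadius N d σ k := fun k hxk => by
    refine hu.trans ?_
    unfold levelRadius
    gcongr
  have hex : ∃ k : ℕ, 0 < k ∧ k ≤ d ∧ x ≤ k * √(logFactor d k) := by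
    refine ⟨d, hd1, le_rfl, hxd.trans (le_mul_of_one_le_right (Nat.cast_nonneg d) ?_)⟩
    exact Real.one_le_sqrt.2 (one_le_logFactor (by exact_mod_cast hd1) le_rfl)
  classical
  obtain ⟨hk, hkd, hxk⟩ := Nat.find_spec hex
  have hmin := fun m => Nat.find_min hex (m := m)
  set k := Nat.find hex
  have hlk := h.level_bound k hk hkd
  obtain hk1 | ⟨j, hj, hkj⟩ : k = 1 ∨ ∃ j, 0 < j ∧ k = j + 1 := by
    rcases Nat.lt_or_ge 1 k with h1 | h1
    · exact Or.inr ⟨k - 1, by omega, by omega⟩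
    · exact Or.inl (by omega)
  -- Level `1` may be far too coarse for small `x`. If `s` dominates `L`, the level bound suffices;
  -- otherwise enlarge `u` to the level radius, where `|Xu|²` is of order `σ²L`, and scale the
  -- resulting linear bound back.
  · rw [hk1] at hlk hxk
    have hlow1 := hlow 1 one_pos hd1 hxk
    simp only [Nat.cast_one, one_mul] at hlk hxk hlow1
    set L := logFactor d 1 with hL
    rcases le_or_gt L s with hLs | hLs
    · exact weaken (hlk u (hlev 1 (by simpa using hxk))) (by linarith)
    have hsL : 0 < √L := Real.sqrt_pos.2 (by linarith)
    have hsq : √L * √L = L := Real.mul_self_sqrt (by linarith)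
    set c := √L / x with hc
    have hc0 : 0 < c := by positivity
    have hr1 : levelRadius N d σ 1 = √L * σ / √N := by simp [levelRadius, hL]
    have hcu : l1 (c • u) ≤ levelRadius N d σ 1 := by
      rw [l1_smul hc0.le, hr1]
      calc c * l1 u ≤ c * (x * σ / √N) := by gcongr
        _ = _ := by rw [hc]; field_simp
    have h1 := hlk _ hcu
    have h2 : X.mulVec (c • u) ⬝ᵥ X.mulVec (c • u) ≤ σ ^ 2 * (9 / 4 * L) := by
      refine (mulVec_dotProduct_self_le hX (by positivity) _).trans ?_
      calc l1 (c • u) ^ 2 * (9 / 4 * N) ≤ (√L * σ / √N) ^ 2 * (9 / 4 * N) := by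
            rw [← hr1]
            gcongr
            exact l1_nonneg _
        _ = _ := by
            rw [div_pow, mul_pow, Real.sq_sqrt hN'.le, sq (√L), hsq]
            field_simp
    have h3 : 2 * (X.mulVec (c • u) ⬝ᵥ ξ) ≤ σ ^ 2 * (24 * L) := by
      have : σ ^ 2 * (18 * L + 4 * s) ≤ σ ^ 2 * (22 * L) := by gcongr; linarith
      nlinarith [mul_nonneg (sq_nonneg σ) (by linarith : 0 ≤ L)]
    rw [Matrix.mulVec_smul, smul_dotProduct, smul_eq_mul] at h3
    have h4 : 2 * (X.mulVec u ⬝ᵥ ξ) ≤ σ ^ 2 * (24 * (x * √L)) := by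
      have e1 : 2 * (c * (X.mulVec u ⬝ᵥ ξ)) = c * (2 * (X.mulVec u ⬝ᵥ ξ)) := by ring
      have e2 : σ ^ 2 * (24 * L) = c * (σ ^ 2 * (24 * (x * √L))) := by
        have : c * (σ ^ 2 * (24 * (x * √L))) = σ ^ 2 * (24 * (√L * √L)) := by
          rw [hc]; field_simp
        rw [this, hsq]
      rw [e1, e2] at h3
      exact le_of_mul_le_mul_left h3 hc0
    have h5 : 0 ≤ X.mulVec u ⬝ᵥ X.mulVec u := Finset.sum_nonneg fun i _ => mul_self_nonneg _
    refine weaken (le_add_of_nonneg_of_le (by linarith) h4) ?_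
    linarith
  -- By minimality of `k` the previous level is below `x`, and `k ≤ 2j`, so the level bound loses
  -- only a constant factor.
  · have hxj : j * √(logFactor d j) < x := by
      by_contra! hcon
      exact hmin j (by omega) ⟨hj, by omega, hcon⟩
    have hj' : (1 : ℝ) ≤ j := by exact_mod_cast hj
    have hjk : (j : ℝ) ≤ k := by exact_mod_cast (by omega : j ≤ k)
    have hkd' : (k : ℝ) ≤ d := by exact_mod_cast hkd
    have hLk := one_le_logFactor (by linarith) hkd'
    have hmono : √(logFactor d k) ≤ √(logFactor d j) := by
      unfold logFactor
      have : (0 : ℝ) < d := by linarith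
      exact Real.sqrt_le_sqrt (Real.log_le_log (by positivity) (by gcongr))
    have hk2 : (k : ℝ) ≤ 2 * j := by rw [hkj]; push_cast; linarith
    have h1 : k * logFactor d k ≤ 2 * (x * √(logFactor d k)) := by
      calc k * logFactor d k = k * √(logFactor d k) * √(logFactor d k) := by
            rw [mul_assoc, Real.mul_self_sqrt (by linarith)]
        _ ≤ 2 * j * √(logFactor d j) * √(logFactor d k) := by gcongr
        _ = 2 * (j * √(logFactor d j)) * √(logFactor d k) := by ring
        _ ≤ 2 * x * √(logFactor d k) := by gcongr
        _ = _ := by ring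
    have h2 := hlow k hk hkd hxk
    exact weaken (hlk u (hlev k hxk)) (by linarith)

theorem IsGoodNoise.dotProduct_le {N d : ℕ} (hN : 0 < N) {σ s : ℝ} (hσ : 0 < σ)
    (hs : 0 ≤ s) {X : Matrix (Fin N) (Fin d) ℝ} (hX : ∀ j, X.col j ⬝ᵥ X.col j ≤ 9 / 4 * N)
    {ξ : Fin N → ℝ} (h : IsGoodNoise X σ s ξ) {ρ : ℝ} {u : Fin d → ℝ} (hu : l1 u ≤ ρ) :
    2 * (X.mulVec u ⬝ᵥ ξ) ≤ (X.mulVec u ⬝ᵥ X.mulVec u) / 2 +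
      51 * (N * rate X σ ρ + σ ^ 2 * s) := by
  have hN' : (0 : ℝ) < N := by exact_mod_cast hN
  have hn : 0 < √(N : ℝ) := Real.sqrt_pos.2 hN'
  rw [rate_eq_normalized hN hσ]
  have hρ : 0 ≤ ρ := (l1_nonneg u).trans hu
  rcases hρ.eq_or_lt with h0 | h0
  · rw [eq_zero_of_l1_le_zero (hu.trans h0.symm.le), ← h0]
    simp
    positivity
  · have := h.dotProduct_le_normalized hN hσ hs hX (x := ρ * √N / σ) (u := u) (by positivity)
      (by convert hu using 1; field_simp)
    linarith

/-! ### Doubling of the rate and the risk bound -/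

theorem midTerm_nonneg {N d : ℕ} {σ ρ : ℝ} (hσ : 0 ≤ σ) (hρ : 0 ≤ ρ) : 0 ≤ midTerm N d σ ρ := by
  unfold midTerm; positivity

theorem rate_nonneg {N d : ℕ} (X : Matrix (Fin N) (Fin d) ℝ) {σ ρ : ℝ} (hσ : 0 ≤ σ)
    (hρ : 0 ≤ ρ) : 0 ≤ rate X σ ρ :=
  le_min (by positivity) (le_min (midTerm_nonneg hσ hρ) (by positivity))

theorem midTerm_two_mul_le {N d : ℕ} (hN : 0 < N) (hd : 0 < d) {σ ρ : ℝ} (hσ : 0 < σ)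
    (hρ : 0 ≤ ρ) : midTerm N d σ (2 * ρ) ≤ 2 * midTerm N d σ ρ := by
  rcases hρ.eq_or_lt with rfl | hρ
  · simp [midTerm]
  have hN' : (0 : ℝ) < N := by exact_mod_cast hN
  have hd' : (0 : ℝ) < d := by exact_mod_cast hd
  have hn : 0 < √(N : ℝ) := Real.sqrt_pos.2 hN'
  unfold midTerm
  rw [mul_assoc 2 ρ σ, mul_assoc 2]
  have h : Real.log (Real.exp 1 * σ * d / (2 * ρ * √N)) ≤
      Real.log (Real.exp 1 * σ * d / (ρ * √N)) := by
    refine Real.log_le_log (by positivity) ?_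
    gcongr
    linarith
  gcongr

theorem rate_two_mul_le {N d : ℕ} (hN : 0 < N) (hd : 0 < d) (X : Matrix (Fin N) (Fin d) ℝ)
    {σ ρ : ℝ} (hσ : 0 < σ) (hρ : 0 ≤ ρ) : rate X σ (2 * ρ) ≤ 2 * rate X σ ρ := by
  have h0 : 0 ≤ σ ^ 2 * X.rank / N := by positivity
  unfold rate
  rw [mul_min_of_nonneg _ _ zero_le_two, mul_min_of_nonneg _ _ zero_le_two]
  refine min_le_min (by linarith) (min_le_min (midTerm_two_mul_le hN hd hσ hρ) (le_of_eq (by ring)))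

/-- Twice the larger norm dominates `‖t - t'‖₁`, and doubling the radius at most doubles the rate.
The noise bound accepts any larger radius, so monotonicity of the rate is not needed. -/
theorem exists_radius_rate_le {N d : ℕ} (hN : 0 < N) (hd : 0 < d) (X : Matrix (Fin N) (Fin d) ℝ)
    {σ : ℝ} (hσ : 0 < σ) (t t' : Fin d → ℝ) :
    ∃ ρ, l1 (t - t') ≤ ρ ∧ rate X σ ρ ≤ 2 * (rate X σ (l1 t) + rate X σ (l1 t')) := by
  have h1 := rate_nonneg X hσ.le (l1_nonneg t)
  have h2 := rate_nonneg X hσ.le (l1_nonneg t')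
  have hsub := l1_sub_le t t'
  rcases le_total (l1 t) (l1 t') with h | h
  · exact ⟨2 * l1 t', by linarith, (rate_two_mul_le hN hd X hσ (l1_nonneg t')).trans (by linarith)⟩
  · exact ⟨2 * l1 t, by linarith, (rate_two_mul_le hN hd X hσ (l1_nonneg t)).trans (by linarith)⟩

theorem mul_empSq {N : ℕ} (hN : 0 < N) (u : Fin N → ℝ) : N * empSq u = u ⬝ᵥ u := by
  have hN' : (0 : ℝ) < N := by exact_mod_cast hN
  unfold empSq dotProduct
  rw [mul_div_cancel₀ _ hN'.ne']
  exact Finset.sum_congr rfl fun i _ => sq _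

/-- The risk of a regularized minimizer at a good noise vector. -/
theorem IsGoodNoise.empSq_le {N d : ℕ} (hN : 0 < N) (hd : 0 < d) {σ s : ℝ} (hσ : 0 < σ)
    (hs : 0 ≤ s) {X : Matrix (Fin N) (Fin d) ℝ} (hX : ∀ j, X.col j ⬝ᵥ X.col j ≤ 9 / 4 * N)
    {ξ : Fin N → ℝ} (h : IsGoodNoise X σ s ξ) {C₁ C₂ c₀ : ℝ} (hC₁ : 51 ≤ C₁) (hc₀ : 2 ≤ c₀)
    {Γ : ℝ → ℝ} (hΓ : ∀ ρ, C₁ ≤ Γ ρ ∧ Γ ρ ≤ C₂) {tstar t : Fin d → ℝ}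
    (ht : IsRERM X (fun ρ => c₀ * rbarSq Γ X σ ρ) (X.mulVec tstar + ξ) t) :
    empSq (X.mulVec (t - tstar)) ≤
      (204 + 2 * c₀ * C₂) * rate X σ (l1 tstar) + 102 * (σ ^ 2 / N * s) := by
  have hN' : (0 : ℝ) < N := by exact_mod_cast hN
  obtain ⟨ρ, hρ, hrate⟩ := exists_radius_rate_le hN hd X hσ t tstar
  have hdot := h.dotProduct_le hN hσ hs hX hρ
  have hopt := mul_le_mul_of_nonneg_left (ht tstar) hN'.le
  set u := t - tstar with hu
  have e1 : X.mulVec tstar + ξ - X.mulVec t = ξ - X.mulVec u := by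
    rw [hu, Matrix.mulVec_sub]; abel
  have e2 : X.mulVec tstar + ξ - X.mulVec tstar = ξ := by abel
  rw [e1, e2, mul_add, mul_add, mul_empSq hN, mul_empSq hN, sub_dotProduct, dotProduct_sub,
    dotProduct_sub, dotProduct_comm ξ (X.mulVec u)] at hopt
  set r := rate X σ (l1 t) with hr
  set r' := rate X σ (l1 tstar) with hr'
  have hr0 : 0 ≤ r := rate_nonneg X hσ.le (l1_nonneg t)
  have hr0' : 0 ≤ r' := rate_nonneg X hσ.le (l1_nonneg tstar)
  -- The penalty of `t` pays for its share `51 · 2` of the noise bound; this dictates `C₁ ≥ 51` with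
  -- `c₀ ≥ 2`.
  have h1 : 102 * r ≤ c₀ * rbarSq Γ X σ (l1 t) := by
    unfold rbarSq
    rw [← hr, ← mul_assoc]
    have : 2 * 51 ≤ c₀ * Γ (l1 t) :=
      mul_le_mul hc₀ (hC₁.trans (hΓ _).1) (by norm_num) (by linarith)
    exact mul_le_mul_of_nonneg_right (by linarith) hr0
  have h2 : c₀ * rbarSq Γ X σ (l1 tstar) ≤ c₀ * (C₂ * r') := by
    unfold rbarSq
    rw [← hr']
    exact mul_le_mul_of_nonneg_left (mul_le_mul_of_nonneg_right (hΓ _).2 hr0') (by linarith)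
  have h1' := mul_le_mul_of_nonneg_left h1 hN'.le
  have h2' := mul_le_mul_of_nonneg_left h2 hN'.le
  have h3' := mul_le_mul_of_nonneg_left hrate hN'.le
  refine le_of_mul_le_mul_left ?_ hN'
  rw [mul_empSq hN]
  have e3 : N * ((204 + 2 * c₀ * C₂) * r' + 102 * (σ ^ 2 / N * s)) =
      204 * (N * r') + 2 * (N * (c₀ * (C₂ * r'))) + 102 * (σ ^ 2 * s) := by
    field_simp
  rw [e3]
  linarith

theorem noise_badEvent_le {N d : ℕ} (hN : 0 < N) (hd : 0 < d) {σ s : ℝ} (hσ : 0 < σ)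
    (hs : 0 ≤ s) {X : Matrix (Fin N) (Fin d) ℝ} (hX : ∀ j, X.col j ⬝ᵥ X.col j ≤ 9 / 4 * N)
    {C₁ C₂ c₀ : ℝ} (hC₁ : 51 ≤ C₁) (hc₀ : 2 ≤ c₀)
    {Γ : ℝ → ℝ} (hΓ : ∀ ρ, C₁ ≤ Γ ρ ∧ Γ ρ ≤ C₂) {tstar : Fin d → ℝ} {b : ℝ}
    (hb : (204 + 2 * c₀ * C₂) * rate X σ (l1 tstar) + 102 * (σ ^ 2 / N * s) ≤ b) :
    noise N σ (badEvent X (fun ρ => c₀ * rbarSq Γ X σ ρ) tstar b) ≤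
      ENNReal.ofReal (2 * Real.exp (-s)) := by
  refine (measure_mono ?_).trans (noise_not_isGoodNoise_le hN hσ hX s)
  rintro ξ ⟨t, ht, hbt⟩ hξ
  exact hbt.not_ge ((hξ.empSq_le hN hd hσ hs hX hC₁ hc₀ hΓ ht).trans hb)

theorem noise_badEvent_le_exp {N d : ℕ} (hN : 0 < N) (hd : 0 < d) {σ : ℝ} (hσ : 0 < σ)
    {X : Matrix (Fin N) (Fin d) ℝ} (hX : ∀ j, empSq (fun i => X i j) ≤ 1)
    {C₁ C₂ c₀ : ℝ} (hC₁ : 51 ≤ C₁) (hC₂ : C₁ ≤ C₂) (hc₀ : 2 ≤ c₀)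
    {Γ : ℝ → ℝ} (hΓ : ∀ ρ, C₁ ≤ Γ ρ ∧ Γ ρ ≤ C₂) (tstar : Fin d → ℝ) :
    noise N σ (badEvent X (fun ρ => c₀ * rbarSq Γ X σ ρ) tstar
        ((306 + 2 * c₀ * C₂) * rate X σ (l1 tstar))) ≤
      ENNReal.ofReal (2 * Real.exp (-(1 / C₂ * N * rbarSq Γ X σ (l1 tstar) / σ ^ 2))) := by
  have hN' : (0 : ℝ) < N := by exact_mod_cast hN
  set r := rate X σ (l1 tstar) with hr
  have hr0 : 0 ≤ r := rate_nonneg X hσ.le (l1_nonneg tstar)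
  have hcol : ∀ j, X.col j ⬝ᵥ X.col j ≤ 9 / 4 * N := fun j => by
    have h1 := mul_le_mul_of_nonneg_left (hX j) hN'.le
    rw [mul_empSq hN] at h1
    exact h1.trans (by linarith)
  -- This `s` makes the deviation term `σ²s/N` equal to the rate, whence `306 = 204 + 102`.
  refine (noise_badEvent_le hN hd hσ (s := N * r / σ ^ 2) (by positivity) hcol hC₁ hc₀ hΓ ?_).trans
    ?_
  · have e : σ ^ 2 / N * (N * r / σ ^ 2) = r := by field_simp
    rw [e]
    linarith
  · have hC : 0 < C₂ := by linarith
    have h1 : 1 / C₂ * N * rbarSq Γ X σ (l1 tstar) / σ ^ 2 ≤ N * r / σ ^ 2 := by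
      gcongr ?_ / σ ^ 2
      unfold rbarSq
      calc 1 / C₂ * N * (Γ (l1 tstar) * r) ≤ 1 / C₂ * N * (C₂ * r) := by
            gcongr
            exact (hΓ _).2
        _ = N * r := by field_simp
    gcongr

/-! ### Minimaxity under the restricted isometry property -/

/-- Coordinate vectors are admissible since the sparsity level exceeds `1`. They bound the column
norms by `3/2` and show that `X ≠ 0`. -/
theorem RIP.isoAt_single {N d : ℕ} {X : Matrix (Fin N) (Fin d) ℝ} (h : RIP X) (j : Fin d) :
    IsoAt X (Pi.single j 1) := by
  rcases lt_or_ge N d with hNd | hNd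
  · obtain ⟨h1, h2⟩ := h.1 hNd
    refine h2 _ (le_trans ?_ h1.le)
    have : (Finset.univ.filter fun i => (Pi.single j 1 : Fin d → ℝ) i ≠ 0) = {j} := by
      ext i; simp [Pi.single_apply]
    rw [this]
    simp
  · exact h.2 hNd _

theorem RIP.empSq_col {N d : ℕ} {X : Matrix (Fin N) (Fin d) ℝ} (h : RIP X) (j : Fin d) :
    0 < empSq (X.col j) ∧ empSq (X.col j) ≤ 9 / 4 := by
  obtain ⟨h1, h2⟩ := h.isoAt_single j
  have e : √(∑ i, (Pi.single j 1 : Fin d → ℝ) i ^ 2) = 1 := by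
    simp [Pi.single_apply]
  rw [e, Matrix.mulVec_single_one] at h1 h2
  refine ⟨Real.sqrt_pos.1 (by linarith), ?_⟩
  rw [mul_one, Real.sqrt_le_left (by norm_num)] at h2
  norm_num at h2
  exact h2

theorem RIP.one_le_rank {N d : ℕ} (hd : 0 < d) {X : Matrix (Fin N) (Fin d) ℝ} (h : RIP X) :
    1 ≤ X.rank := by
  by_contra! hr
  have hX : LinearMap.range X.mulVecLin = ⊥ := Submodule.finrank_eq_zero.1 (by
    have : X.rank = 0 := by omega
    exact this)
  have h0 : X.col ⟨0, hd⟩ = 0 := by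
    have := LinearMap.congr_fun (LinearMap.range_eq_bot.1 hX) (Pi.single ⟨0, hd⟩ 1)
    simpa using this
  have := (h.empSq_col ⟨0, hd⟩).1
  rw [h0] at this
  simp [empSq] at this

/-- The regularization function is minimax under the restricted isometry property. -/
theorem isMinimaxRegularization_of_RIP {N d : ℕ} (hN : 0 < N) (hd : 0 < d) {σ : ℝ} (hσ : 0 < σ)
    {X : Matrix (Fin N) (Fin d) ℝ} (hX : RIP X) {C₁ C₂ c₀ A g₀ : ℝ} (hA : 0 < A) (hg₀ : 0 < g₀)
    (hC₁ : 51 ≤ C₁) (hC₂ : C₁ ≤ C₂) (hc₀ : 2 ≤ c₀) {Γ : ℝ → ℝ}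
    (hΓ : ∀ ρ, C₁ ≤ Γ ρ ∧ Γ ρ ≤ C₂)
    (hR : ∀ ρ : ℝ, 0 ≤ ρ → IsMinimaxRate g₀ X σ (1 / 4) {t | l1 t ≤ ρ} (A * l1BallRate X σ ρ)) :
    IsMinimaxRegularization g₀ ((612 + 2 * c₀ * C₂) / (g₀ * A)) X σ (1 / 4)
      {t | 1 * σ * √(Real.log (Real.exp 1 * d) / N) < l1 t}
      (fun ρ => c₀ * rbarSq Γ X σ ρ) := by
  intro tstar htstar R hRmin
  have hN' : (0 : ℝ) < N := by exact_mod_cast hN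
  have hd' : (1 : ℝ) ≤ d := by exact_mod_cast hd
  have hn : 0 < √(N : ℝ) := Real.sqrt_pos.2 hN'
  rw [Set.mem_ofPred_eq, one_mul] at htstar
  set ρ := l1 tstar with hρ
  have hρ0 : 0 ≤ ρ := l1_nonneg tstar
  set r := rate X σ ρ with hr
  have hr0 : 0 ≤ r := rate_nonneg X hσ.le hρ0
  -- An estimator attaining `R` is subject to the lower bound of the assumed rate.
  have hlow : g₀ * (A * l1BallRate X σ ρ) ≤ R := by
    obtain ⟨est, hest, hperf⟩ := hRmin.1
    exact (hR ρ hρ0).2 est R hest hperf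
  have hrl : r ≤ l1BallRate X σ ρ := by
    refine min_le_min le_rfl (min_le_min le_rfl ?_)
    rw [mul_assoc, sq]
    exact mul_le_mul_of_nonneg_left htstar.le hρ0
  have hlog : 1 ≤ logFactor d 1 := one_le_logFactor one_pos hd'
  have hx : 1 ≤ ρ * √N / σ := by
    rw [one_le_div hσ]
    have h1 : σ * √(1 / N) ≤ ρ := by
      refine le_trans ?_ htstar.le
      rw [logFactor, div_one] at hlog
      gcongr
    rw [Real.sqrt_div' _ hN'.le, Real.sqrt_one] at h1
    calc σ = σ * (1 / √N) * √N := by field_simp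
      _ ≤ _ := by gcongr
  have hr1 : σ ^ 2 / N ≤ r := by
    rw [div_le_iff₀ hN', mul_comm, rate_eq_normalized hN hσ]
    refine le_mul_of_one_le_right (sq_nonneg σ) (le_min ?_ (le_min ?_ ?_))
    · exact_mod_cast hX.one_le_rank hd
    · exact one_le_mul_of_one_le_of_one_le hx (Real.one_le_sqrt.2 (le_max_left _ _))
    · exact one_le_mul_of_one_le_of_one_le hx (Real.one_le_sqrt.2 hlog)
  have hcol : ∀ j, X.col j ⬝ᵥ X.col j ≤ 9 / 4 * N := fun j => by
    rw [← mul_empSq hN, mul_comm]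
    exact mul_le_mul_of_nonneg_right (hX.empSq_col j).2 hN'.le
  -- The extra `3` brings the probability to `2e⁻³ ≤ 1/4`. It costs `102 · 3σ²/N ≤ 306r`, and `204 +
  -- 102 + 306 = 612`.
  refine (noise_badEvent_le hN hd hσ (s := N * r / σ ^ 2 + 3) (by positivity) hcol hC₁ hc₀
    hΓ ?_).trans ?_
  · have e : σ ^ 2 / N * (N * r / σ ^ 2 + 3) = r + 3 * (σ ^ 2 / N) := by field_simp
    have hc : 0 ≤ c₀ * C₂ := mul_nonneg (by linarith) (by linarith)
    rw [e]
    calc (204 + 2 * c₀ * C₂) * r + 102 * (r + 3 * (σ ^ 2 / N))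
        ≤ (612 + 2 * c₀ * C₂) * r := by linarith
      _ ≤ (612 + 2 * c₀ * C₂) * l1BallRate X σ ρ := by gcongr; linarith
      _ = (612 + 2 * c₀ * C₂) / (g₀ * A) * (g₀ * (A * l1BallRate X σ ρ)) := by field_simp
      _ ≤ _ := by
          have : 0 ≤ (612 + 2 * c₀ * C₂) / (g₀ * A) := div_nonneg (by linarith) (by positivity)
          gcongr
  · apply ENNReal.ofReal_le_ofReal
    have h1 : Real.exp (-(N * r / σ ^ 2 + 3)) ≤ Real.exp (-3) := by
      apply Real.exp_le_exp.2
      have : 0 ≤ N * r / σ ^ 2 := by positivity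
      linarith
    have h2 : (2 : ℝ) ^ 3 ≤ Real.exp 3 := by
      have e : Real.exp 3 = Real.exp 1 ^ 3 := by rw [← Real.exp_nat_mul]; norm_num
      rw [e]
      gcongr
      linarith [Real.add_one_le_exp (1 : ℝ)]
    have h3 : Real.exp (-3) ≤ 1 / 8 := by
      rw [Real.exp_neg, ← one_div]
      exact one_div_le_one_div_of_le (by norm_num) (by linarith)
    linarith

/-! ### Existence of minimizers -/

open Filter

/-- Only `ρ = 0` is delicate, as the logarithm in `midTerm` is singular there; the linear third term
squeezes the rate to `0`. -/
theorem continuousOn_rate {N d : ℕ} (hN : 0 < N) (hd : 0 < d) (X : Matrix (Fin N) (Fin d) ℝ)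
    {σ : ℝ} (hσ : 0 < σ) : ContinuousOn (rate X σ) (Set.Ici 0) := by
  have hN' : (0 : ℝ) < N := by exact_mod_cast hN
  have hd' : (0 : ℝ) < d := by exact_mod_cast hd
  have hn : 0 < √(N : ℝ) := Real.sqrt_pos.2 hN'
  intro ρ hρ
  rcases (show (0 : ℝ) ≤ ρ from hρ).eq_or_lt with rfl | hρ
  · have h0 : rate X σ 0 = 0 := by
      have : 0 ≤ σ ^ 2 * X.rank / N := by positivity
      simp [rate, midTerm, this]
    rw [ContinuousWithinAt, h0]
    refine tendsto_of_tendsto_of_tendsto_of_le_of_le' (tendsto_const_nhds (x := (0 : ℝ)))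
      (h := fun ρ => ρ * σ * √(Real.log (Real.exp 1 * d) / N)) ?_ ?_ ?_
    · have : Continuous fun ρ : ℝ => ρ * σ * √(Real.log (Real.exp 1 * d) / N) := by fun_prop
      simpa using (this.tendsto 0).mono_left nhdsWithin_le_nhds
    · filter_upwards [self_mem_nhdsWithin] with ρ hρ using rate_nonneg X hσ.le hρ
    · exact Eventually.of_forall fun ρ => (min_le_right _ _).trans (min_le_right _ _)
  · apply ContinuousAt.continuousWithinAt
    have h1 : ρ * √N ≠ 0 := by positivity
    have h2 : Real.exp 1 * σ * d / (ρ * √N) ≠ 0 := by positivity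
    have h3 : ContinuousAt (midTerm N d σ) ρ := by
      unfold midTerm
      have hlog : ContinuousAt (fun ρ : ℝ => Real.log (Real.exp 1 * σ * d / (ρ * √N))) ρ :=
        ContinuousAt.log (ContinuousAt.div₀ (by fun_prop) (by fun_prop) h1) h2
      have hmax := (continuousAt_const (y := (1 : ℝ))).max hlog
      exact ContinuousAt.mul (by fun_prop) (hmax.div_const _).sqrt
    unfold rate
    have h4 : ContinuousAt (fun ρ : ℝ => ρ * σ * √(Real.log (Real.exp 1 * d) / N)) ρ := by
      fun_prop
    exact Filter.Tendsto.min tendsto_const_nhds (Filter.Tendsto.min h3 h4)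

theorem rate_le_rank {N d : ℕ} (X : Matrix (Fin N) (Fin d) ℝ) (σ ρ : ℝ) :
    rate X σ ρ ≤ σ ^ 2 * X.rank / N := min_le_left _ _

/-- In the normalized radius both other terms are at least `d`, hence at least the rank. -/
theorem rate_eq_rank {N d : ℕ} (hN : 0 < N) (hd : 0 < d) (X : Matrix (Fin N) (Fin d) ℝ)
    {σ ρ : ℝ} (hσ : 0 < σ) (hρ : σ * d / √N ≤ ρ) : rate X σ ρ = σ ^ 2 * X.rank / N := by
  have hN' : (0 : ℝ) < N := by exact_mod_cast hN
  have hd' : (1 : ℝ) ≤ d := by exact_mod_cast hd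
  have hn : 0 < √(N : ℝ) := Real.sqrt_pos.2 hN'
  have hx : (d : ℝ) ≤ ρ * √N / σ := by
    rw [div_le_iff₀ hn] at hρ
    rw [le_div_iff₀ hσ]
    linarith
  have hrd : (X.rank : ℝ) ≤ d := by exact_mod_cast X.rank_le_width
  have hx0 : 0 ≤ ρ * √N / σ := by linarith
  rw [eq_div_iff hN'.ne', mul_comm, rate_eq_normalized hN hσ, min_eq_left]
  refine le_min ?_ ?_
  · exact (hrd.trans hx).trans
      (le_mul_of_one_le_right hx0 (Real.one_le_sqrt.2 (le_max_left _ _)))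
  · exact (hrd.trans hx).trans
      (le_mul_of_one_le_right hx0 (Real.one_le_sqrt.2 (one_le_logFactor one_pos hd')))

theorem exists_least_squares {N d : ℕ} (hN : 0 < N) (X : Matrix (Fin N) (Fin d) ℝ)
    (y : Fin N → ℝ) : ∃ t, ∀ s, empSq (y - X.mulVec t) ≤ empSq (y - X.mulVec s) := by
  let e := (WithLp.linearEquiv 2 ℝ (Fin N → ℝ)).symm
  let S : Submodule ℝ (EuclideanSpace ℝ (Fin N)) := (LinearMap.range X.mulVecLin).map e.toLinearMap
  obtain ⟨_, ⟨_, ⟨t, rfl⟩, rfl⟩, ht⟩ := S.exists_norm_eq_iInf_of_complete_subspace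
    (completeSpace_coe_iff_isComplete.1 (FiniteDimensional.complete ℝ S)) (WithLp.toLp 2 y)
  refine ⟨t, fun s => ?_⟩
  have hle := ciInf_le (f := fun w : S => ‖WithLp.toLp 2 y - (w : EuclideanSpace ℝ (Fin N))‖)
    ⟨0, by rintro _ ⟨w, rfl⟩; exact norm_nonneg _⟩ ⟨_, ⟨X.mulVec s, ⟨s, rfl⟩, rfl⟩⟩
  have h := ht.le.trans hle
  have hn : ∀ v : Fin N → ℝ, empSq v = ‖WithLp.toLp 2 v‖ ^ 2 / N := fun v => by
    rw [EuclideanSpace.real_norm_sq_eq, empSq]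
  rw [hn, hn]
  gcongr
  exact h

theorem continuous_l1 {d : ℕ} : Continuous (l1 : (Fin d → ℝ) → ℝ) := by
  unfold l1; fun_prop

theorem isCompact_l1_le {d : ℕ} (R : ℝ) : IsCompact {t : Fin d → ℝ | l1 t ≤ R} := by
  refine Metric.isCompact_of_isClosed_isBounded (isClosed_le continuous_l1 continuous_const) ?_
  refine (Metric.isBounded_closedBall (x := (0 : Fin d → ℝ)) (r := R)).subset fun t ht => ?_
  have hR : 0 ≤ R := (l1_nonneg t).trans ht
  rw [mem_closedBall_zero_iff, pi_norm_le_iff_of_nonneg hR]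
  intro j
  rw [Real.norm_eq_abs]
  exact (Finset.single_le_sum (f := fun j => |t j|) (fun j _ => abs_nonneg _)
    (Finset.mem_univ j)).trans ht

/-- The objective need not be coercive when `X` has a kernel. Beyond radius `σd/√N` the penalty is
constant and maximal, so a least squares solution `t₀` does at least as well as any point out there;
a minimizer over a ball containing `t₀` is then global. -/
theorem exists_isRERM {N d : ℕ} (hN : 0 < N) (hd : 0 < d) (X : Matrix (Fin N) (Fin d) ℝ)
    {σ : ℝ} (hσ : 0 < σ) {c₀ C : ℝ} (hc₀ : 0 ≤ c₀) (hC : 0 ≤ C) (y : Fin N → ℝ) :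
    ∃ t, IsRERM X (fun ρ => c₀ * rbarSq (fun _ => C) X σ ρ) y t := by
  obtain ⟨t₀, ht₀⟩ := exists_least_squares hN X y
  set R := max (σ * d / √N) (l1 t₀) with hR
  set F : (Fin d → ℝ) → ℝ := fun t =>
    empSq (y - X.mulVec t) + c₀ * rbarSq (fun _ => C) X σ (l1 t) with hF
  have hcont : Continuous F := by
    have h1 : Continuous fun t : Fin d → ℝ => rate X σ (l1 t) :=
      (continuousOn_rate hN hd X hσ).comp_continuous continuous_l1 fun t => l1_nonneg t
    have h2 : Continuous fun t => X.mulVec t :=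
      Continuous.matrix_mulVec continuous_const continuous_id
    unfold F rbarSq empSq
    simp only [Pi.sub_apply]
    fun_prop
  obtain ⟨t, -, ht⟩ := (isCompact_l1_le R).exists_isMinOn
    ⟨t₀, show l1 t₀ ≤ R from le_max_right _ _⟩ hcont.continuousOn
  refine ⟨t, fun s => ?_⟩
  rcases le_or_gt (l1 s) R with hs | hs
  · exact ht hs
  · refine (ht (show l1 t₀ ≤ R from le_max_right _ _)).trans ?_
    refine add_le_add (ht₀ s) ?_
    beta_reduce
    unfold rbarSq
    rw [rate_eq_rank hN hd X hσ ((le_max_left _ _).trans hs.le)]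
    gcongr
    exact rate_le_rank X σ _

end FixedDesign

theorem theorem3 :
    ∃ C₀ : ℝ, 0 < C₀ ∧ ∀ C₁ C₂ c₀ : ℝ, C₀ ≤ C₁ → C₁ ≤ C₂ → 2 ≤ c₀ →
      -- the risk bound, with constants that depend on `C₁, C₂, c₀` only
      (∃ κ₁ κ₂ κ₃ : ℝ, 0 < κ₁ ∧ 0 < κ₂ ∧ 0 < κ₃ ∧
        ∀ (N d : ℕ) (X : Matrix (Fin N) (Fin d) ℝ) (σ : ℝ) (Γ : ℝ → ℝ) (tstar : Fin d → ℝ),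
          0 < N → 0 < d → 0 < σ →
          (∀ j, FixedDesign.empSq (fun i => X i j) ≤ 1) →
          (∀ ρ, C₁ ≤ Γ ρ ∧ Γ ρ ≤ C₂) →
          FixedDesign.noise N σ
              (FixedDesign.badEvent X (fun ρ => c₀ * FixedDesign.rbarSq Γ X σ ρ) tstar
                (κ₃ * FixedDesign.rate X σ (FixedDesign.l1 tstar))) ≤
            ENNReal.ofReal (κ₁ * Real.exp
              (-(κ₂ * N * FixedDesign.rbarSq Γ X σ (FixedDesign.l1 tstar) / σ ^ 2)))) ∧
      -- minimizers exist when the factor is a constant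
      (∀ (N d : ℕ) (X : Matrix (Fin N) (Fin d) ℝ) (σ C : ℝ) (y : Fin N → ℝ),
        0 < N → 0 < d → 0 < σ → C₁ ≤ C → C ≤ C₂ →
        ∃ t, FixedDesign.IsRERM X
          (fun ρ => c₀ * FixedDesign.rbarSq (fun _ => C) X σ ρ) y t) ∧
      -- minimaxity under RIP, if the minimax rate over `ℓ₁` balls is the expected one
      (∃ Δ₀ : ℝ, 0 < Δ₀ ∧ ∀ A g₀ : ℝ, 0 < A → 0 < g₀ → ∃ g₁ : ℝ, 0 < g₁ ∧
        ∀ (N d : ℕ) (X : Matrix (Fin N) (Fin d) ℝ) (σ : ℝ) (Γ : ℝ → ℝ),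
          0 < N → 0 < d → 0 < σ → FixedDesign.RIP X →
          (∀ ρ, C₁ ≤ Γ ρ ∧ Γ ρ ≤ C₂) →
          (∀ ρ : ℝ, 0 ≤ ρ → FixedDesign.IsMinimaxRate g₀ X σ (1 / 4)
            {t | FixedDesign.l1 t ≤ ρ} (A * FixedDesign.l1BallRate X σ ρ)) →
          FixedDesign.IsMinimaxRegularization g₀ g₁ X σ (1 / 4)
            {t | Δ₀ * σ * √(Real.log (Real.exp 1 * d) / N) < FixedDesign.l1 t}
            (fun ρ => c₀ * FixedDesign.rbarSq Γ X σ ρ)) := by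
  refine ⟨51, by norm_num, fun C₁ C₂ c₀ hC₁ hC₂ hc₀ => ⟨?_, ?_, ?_⟩⟩
  · have hC : 0 < C₂ := by linarith
    have hc : 0 < c₀ := by linarith
    refine ⟨2, 1 / C₂, 306 + 2 * c₀ * C₂, by norm_num, by positivity, by positivity, ?_⟩
    intro N d X σ Γ tstar hN hd hσ hX hΓ
    exact FixedDesign.noise_badEvent_le_exp hN hd hσ hX hC₁ hC₂ hc₀ hΓ tstar
  · intro N d X σ C y hN hd hσ hC _
    exact FixedDesign.exists_isRERM hN hd X hσ (by linarith) (by linarith) y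
  · have hC : 0 < C₂ := by linarith
    have hc : 0 < c₀ := by linarith
    refine ⟨1, one_pos, fun A g₀ hA hg₀ => ⟨(612 + 2 * c₀ * C₂) / (g₀ * A), by positivity, ?_⟩⟩
    intro N d X σ Γ hN hd hσ hX hΓ hR
    exact FixedDesign.isMinimaxRegularization_of_RIP hN hd hσ hX hA hg₀ hC₁ hC₂ hc₀ hΓ hR
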